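/- Let $V$ be a $\mathbb{Q}$-graded vertex operator algebra over $\mathbb{C}$, i.e. $V=\bigoplus_{\alpha\in\mathbb{Q}}V_{(\alpha)}$ satisfies all the axioms of a vertex operator algebra (with finite-dimensional $V_{(\alpha)}$, the $L(0)$-eigenspace of eigenvalue $\alpha$, and $V_{(\alpha)}=0$ for $\alpha$ sufficiently negative) except that the grading is by $\mathbb{Q}$ instead of $\mathbb{Z}$. Suppose that $V=\bigoplus_{\alpha\in\frac{1}{2r}\mathbb{Z}}V_{(\alpha)}$ for some positive integer $r$. Let $(W,Y_W)$ be a $V$-module: $Y_W:V\to\mathrm{Hom}(W,W((x)))$ is linear, $Y_W(\mathbf 1,x)=1$, the Jacobi identity holds, and $W=\bigoplus_{\alpha\in\mathbb{C}}W_{(\alpha)}$ is graded by the eigenvalues of $L(0)$ with $\dim W_{(\alpha)}<\infty$ and, for each $\alpha$, $W_{(\alpha+n)}=0$ for all sufficiently negative integers $n$ (the grading restrictions). Let $W'=\bigoplus_{\alpha\in\mathbb{C}}W_{(\alpha)}^{*}$ be the restricted dual. Then $\sigma=e^{4\pi iL(0)}$ is an automorphism of the vertex operator algebra $V$ with $\sigma^r=1$;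 let $k$ be its order and put $\omega_k=e^{2\pi i/k}$. The formula $$\langle Y_{W'}(v,z)w',w\rangle=\langle w',Y_W(e^{zL(1)}e^{\pi iL(0)}z^{-2L(0)}v,z^{-1})w\rangle\qquad(v\in V,\ w'\in W',\ w\in W)$$ determines a unique linear map $Y_{W'}:V\to\mathrm{Hom}(W',W'((z^{1/k})))$, and $(W',Y_{W'})$ is a $\sigma$-twisted $V$-module, that is: $Y_{W'}(\mathbf 1,z)=1$; $Y_{W'}(\sigma v,z)=\lim_{z^{1/k}\to\omega_k^{-1}z^{1/k}}Y_{W'}(v,z)$ for $v\in V$; for $0\le j\le k-1$, $u\in V$ with $\sigma u=\omega_k^{j}u$, and $v\in V$, $$x_0^{-1}\delta\!\left(\tfrac{x_1-x_2}{x_0}\right)Y_{W'}(u,x_1)Y_{W'}(v,x_2)-x_0^{-1}\delta\!\left(\tfrac{x_2-x_1}{-x_0}\right)Y_{W'}(v,x_2)Y_{W'}(u,x_1)=x_2^{-1}\left(\tfrac{x_1-x_0}{x_2}\right)^{-j/k}\delta\!\left(\tfrac{x_1-x_0}{x_2}\right)Y_{W'}(Y(u,x_0)v,x_2);$$ and $W'$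 is graded by the eigenvalues of $L(0)$ (the coefficient of $z^{-2}$ in $Y_{W'}(\omega,z)$, $\omega$ being the conformal vector) and satisfies the two grading restrictions above. -/

import Mathlib

open scoped DirectSum

noncomputable section

/-- `u_n`: the coefficient of `x ^ (-n-1)` in `Y(u,x)`, for a linear map `Y : V → Hom(W, W((x)))`. -/
def vmode {V W : Type*} [AddCommGroup V] [Module ℂ V] [AddCommGroup W] [Module ℂ W]
    (Y : V →ₗ[ℂ] VertexOperator ℂ W) (u : V) (n : ℤ) : Module.End ℂ W :=
  VertexOperator.ncoeff (Y u) n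

/-- The Jacobi identity
`x₀⁻¹ δ((x₁-x₂)/x₀) Y_W(u,x₁) Y_W(v,x₂) - x₀⁻¹ δ((x₂-x₁)/(-x₀)) Y_W(v,x₂) Y_W(u,x₁)
  = x₂⁻¹ δ((x₁-x₀)/x₂) Y_W(Y(u,x₀)v,x₂)`,
written out as equality of the coefficients of `x₀^(-l-1) x₁^(-m-1) x₂^(-n-1)` of both sides
applied to `w`. All three sums are finite, because `Y(u,x)v ∈ V((x))` and `Y_W(u,x)w ∈ W((x))`. -/
def JacobiIdentity {V W : Type*} [AddCommGroup V] [Module ℂ V] [AddCommGroup W] [Module ℂ W]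
    (Y : V →ₗ[ℂ] VertexOperator ℂ V) (YW : V →ₗ[ℂ] VertexOperator ℂ W) : Prop :=
  ∀ (u v : V) (w : W) (l m n : ℤ),
    (∑ᶠ i : ℕ, ((-1 : ℂ) ^ i * ((Ring.choose l i : ℤ) : ℂ)) •
        vmode YW u (l + m - i) (vmode YW v (n + i) w))
      - (∑ᶠ i : ℕ, ((-1 : ℂ) ^ (l + i) * ((Ring.choose l i : ℤ) : ℂ)) •
        vmode YW v (l + n - i) (vmode YW u (m + i) w))
    = ∑ᶠ i : ℕ, ((Ring.choose m i : ℤ) : ℂ) • vmode YW (vmode Y u (l + i) v) (m + n - i) w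

/-- The grading restrictions on a module with respect to the operator `L₀ = L(0)`: `W` is the
direct sum of the spaces `W_(α) = {w | L(0) w = α w}`, `α ∈ ℂ`; every `W_(α)` is
finite-dimensional; and for every `α`, `W_(α+n) = 0` for all sufficiently negative integers `n`.
(Since `ℤ` has finite index in `(1/T)ℤ`, the last condition is the same as the one with `n`
running over `(1/T)ℤ`, for any positive integer `T`.) -/
structure GradingRestrictions {W : Type*} [AddCommGroup W] [Module ℂ W]
    (L₀ : Module.End ℂ W) : Prop where
  isInternal : DirectSum.IsInternal (fun α : ℂ => L₀.eigenspace α)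
  finiteDimensional : ∀ α : ℂ, FiniteDimensional ℂ (L₀.eigenspace α)
  truncated : ∀ α : ℂ, ∃ N : ℤ, ∀ n : ℤ, n < N → L₀.eigenspace (α + n) = ⊥

/-- A `ℚ`-graded vertex operator algebra structure on the complex vector space `V`. The grading is
by the eigenspaces of `L(0)`, where `Y(ω,x) = ∑ L(n) x^(-n-2)`, that is `L(n) = ω_{n+1}`. -/
structure QGradedVOA (V : Type*) [AddCommGroup V] [Module ℂ V] where
  /-- the vertex operator map `u ↦ Y(u,x) ∈ Hom(V, V((x)))` -/
  Y : V →ₗ[ℂ] VertexOperator ℂ V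
  /-- the vacuum vector -/
  one : V
  /-- the conformal vector -/
  omega : V
  /-- the central charge -/
  c : ℂ
  /-- `Y(1,x) = 1` -/
  vacuum : ∀ n : ℤ, vmode Y one n = if n = -1 then 1 else 0
  /-- `Y(v,x)1 ∈ V[[x]]` -/
  creation : ∀ (v : V) (n : ℤ), 0 ≤ n → vmode Y v n one = 0
  /-- the constant term of `Y(v,x)1` is `v` -/
  creation_neg_one : ∀ v : V, vmode Y v (-1) one = v
  jacobi : JacobiIdentity Y Y
  /-- `[L(m),L(n)] = (m-n) L(m+n) + ((m³-m)/12) δ_{m+n,0} c` -/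
  virasoro : ∀ m n : ℤ,
    vmode Y omega (m + 1) * vmode Y omega (n + 1) - vmode Y omega (n + 1) * vmode Y omega (m + 1)
      = ((m : ℂ) - n) • vmode Y omega (m + n + 1)
        + (if m + n = 0 then ((m : ℂ) ^ 3 - m) / 12 * c else 0) • (1 : Module.End ℂ V)
  /-- `Y(L(-1)v,x) = d/dx Y(v,x)` -/
  derivative : ∀ (v : V) (n : ℤ), vmode Y (vmode Y omega 0 v) n = (-(n : ℂ)) • vmode Y v (n - 1)
  /-- `V` is the direct sum of its homogeneous subspaces `V_(α)`, `α ∈ ℚ` -/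
  isInternal : DirectSum.IsInternal (fun α : ℚ => (vmode Y omega 1).eigenspace (α : ℂ))
  finiteDimensional : ∀ α : ℚ, FiniteDimensional ℂ ((vmode Y omega 1).eigenspace (α : ℂ))
  /-- `V_(α) = 0` for `α` sufficiently negative -/
  truncated : ∃ N : ℚ, ∀ α : ℚ, α < N → (vmode Y omega 1).eigenspace (α : ℂ) = ⊥

namespace QGradedVOA

variable {V : Type*} [AddCommGroup V] [Module ℂ V] (A : QGradedVOA V)

/-- The operator `L(n)` on `V`. -/
def L (n : ℤ) : Module.End ℂ V := vmode A.Y A.omega (n + 1)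

/-- The homogeneous subspace `V_(α)`. -/
def weightSpace (α : ℚ) : Submodule ℂ V := (vmode A.Y A.omega 1).eigenspace (α : ℂ)

/-- The decomposition of vectors of `V` into homogeneous components. -/
def decomp : V ≃ₗ[ℂ] ⨁ α : ℚ, A.weightSpace α :=
  (LinearEquiv.ofBijective (DirectSum.coeLinearMap A.weightSpace) A.isInternal).symm

/-- The projection of `V` onto `V_(α)`, as an endomorphism of `V`. -/
def proj (α : ℚ) : Module.End ℂ V :=
  (A.weightSpace α).subtype ∘ₗ DirectSum.component ℂ ℚ (fun α => A.weightSpace α) α ∘ₗ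
    A.decomp.toLinearMap

/-- The operator `e^{s L(0)}` on `V`: it acts on `V_(α)` as the scalar `e^{s α}`. -/
def expL0 (s : ℂ) : Module.End ℂ V :=
  DirectSum.toModule ℂ ℚ V (fun α => Complex.exp (s * α) • (A.weightSpace α).subtype) ∘ₗ
    A.decomp.toLinearMap

/-- The coefficient of `z^p` in `e^{z L(1)} e^{π i L(0)} z^{-2 L(0)} v`. Here `z^{-2 L(0)} v` is
`∑ z^{-2α} v_(α)`, so that its coefficient of `z^q` is the component of `v` of weight `-q/2`. -/
def adjointArg (v : V) (p : ℚ) : V :=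
  ∑ᶠ k : ℕ, ((k.factorial : ℂ)⁻¹) •
    ((A.L 1) ^ k) (A.expL0 (Real.pi * Complex.I) (A.proj (-(p - k) / 2) v))

/-- `σ` is an automorphism of the vertex operator algebra. -/
structure IsAutomorphism (σ : Module.End ℂ V) : Prop where
  bijective : Function.Bijective σ
  map_one : σ A.one = A.one
  map_omega : σ A.omega = A.omega
  map_mode : ∀ (u v : V) (n : ℤ), σ (vmode A.Y u n v) = vmode A.Y (σ u) n (σ v)

end QGradedVOA

/-- A module structure on `W` for the `ℚ`-graded vertex operator algebra `A`. -/
structure VOAModule {V : Type*} [AddCommGroup V] [Module ℂ V] (A : QGradedVOA V)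
    (W : Type*) [AddCommGroup W] [Module ℂ W] where
  /-- the vertex operator map `v ↦ Y_W(v,x) ∈ Hom(W, W((x)))` -/
  Y : V →ₗ[ℂ] VertexOperator ℂ W
  /-- `Y_W(1,x) = 1` -/
  vacuum : ∀ n : ℤ, vmode Y A.one n = if n = -1 then 1 else 0
  jacobi : JacobiIdentity A.Y Y
  grading : GradingRestrictions (vmode Y A.omega 1)

/-- A vertex operator `F` with values in `Hom(W, W((x^{1/k})))` is given as a Laurent series in the
variable `x^{1/k}`; `fracCoeff k F q` is its coefficient of `x^q` for rational `q`, which is zero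
unless `q ∈ (1/k)ℤ`. -/
def fracCoeff {W : Type*} [AddCommGroup W] [Module ℂ W] (k : ℕ) (F : VertexOperator ℂ W)
    (q : ℚ) : Module.End ℂ W :=
  if (q * k).den = 1 then HVertexOperator.coeff F (q * k).num else 0

/-- `u_q` for rational `q`: the coefficient of `x ^ (-q-1)` in `Y(u,x) ∈ Hom(W, W((x^{1/k})))`. -/
def fracMode {V W : Type*} [AddCommGroup V] [Module ℂ V] [AddCommGroup W] [Module ℂ W]
    (k : ℕ) (Y : V →ₗ[ℂ] VertexOperator ℂ W) (u : V) (q : ℚ) : Module.End ℂ W :=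
  fracCoeff k (Y u) (-q - 1)

/-- The linear map `Y : V → Hom(W, W((x^{1/k})))`, where `k` is the order of the automorphism `σ`
(assumed finite), makes `W` a `σ`-twisted module for the `ℚ`-graded vertex operator algebra `A`.
Laurent series in `x^{1/k}` are written as Laurent series in one variable: the coefficient of index
`n : ℤ` of `Y v` is the coefficient of `x^{n/k}`. -/
structure IsTwistedModule {V : Type*} [AddCommGroup V] [Module ℂ V] (A : QGradedVOA V)
    (σ : Module.End ℂ V) {W : Type*} [AddCommGroup W] [Module ℂ W]
    (Y : V →ₗ[ℂ] VertexOperator ℂ W) : Prop where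
  /-- `Y(1,x) = 1` -/
  vacuum : ∀ n : ℤ, HVertexOperator.coeff (Y A.one) n = if n = 0 then 1 else 0
  /-- `Y(σ v,x)` is obtained from `Y(v,x)` by `x^{1/k} ↦ ω_k⁻¹ x^{1/k}`, `ω_k = exp(2πi/k)` -/
  equivariance : ∀ (v : V) (n : ℤ), HVertexOperator.coeff (Y (σ v)) n =
    (Complex.exp (2 * Real.pi * Complex.I / orderOf σ) ^ (-n)) • HVertexOperator.coeff (Y v) n
  /-- The twisted Jacobi identity, for `u` with `σ u = ω_k^j u`, `0 ≤ j ≤ k-1`: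
  `x₀⁻¹ δ((x₁-x₂)/x₀) Y(u,x₁) Y(v,x₂) - x₀⁻¹ δ((x₂-x₁)/(-x₀)) Y(v,x₂) Y(u,x₁)
    = x₂⁻¹ ((x₁-x₀)/x₂)^(-j/k) δ((x₁-x₀)/x₂) Y(Y(u,x₀)v,x₂)`,
  as equality of the coefficients of `x₀^(-l-1) x₁^(-m-1) x₂^(-n-1)` of both sides applied to `w`.
  Only `m ∈ j/k + ℤ` matters: the right side contains no other powers `x₁^(-m-1)`, and by
  `equivariance` neither does `Y(u,x₁)`. On the right, the coefficient of `x₁^(-m-1) x₀^i` in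
  `(x₁-x₀)^(-m-1+i)` is `(-1)^i * choose (-m-1+i) i = choose m i`. -/
  jacobi : ∀ (j : ℕ) (_ : j < orderOf σ) (u : V)
    (_ : σ u = Complex.exp (2 * Real.pi * Complex.I / orderOf σ) ^ j • u) (v : V) (w : W)
    (l : ℤ) (m n : ℚ) (_ : ∃ s : ℤ, m = (j : ℚ) / orderOf σ + s),
    (∑ᶠ i : ℕ, ((-1 : ℂ) ^ i * ((Ring.choose l i : ℤ) : ℂ)) •
        fracMode (orderOf σ) Y u (l + m - i) (fracMode (orderOf σ) Y v (n + i) w))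
      - (∑ᶠ i : ℕ, ((-1 : ℂ) ^ (l + i) * ((Ring.choose l i : ℤ) : ℂ)) •
        fracMode (orderOf σ) Y v (l + n - i) (fracMode (orderOf σ) Y u (m + i) w))
    = ∑ᶠ i : ℕ, ((Ring.choose m i : ℚ) : ℂ) •
        fracMode (orderOf σ) Y (vmode A.Y u (l + i) v) (m + n - i) w
  /-- `W` is graded by the eigenvalues of `L(0) = ω_1` and satisfies the grading restrictions -/
  grading : GradingRestrictions (fracMode (orderOf σ) Y A.omega 1)

namespace VOAModule

variable {V : Type*} [AddCommGroup V] [Module ℂ V] {A : QGradedVOA V}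
  {W : Type*} [AddCommGroup W] [Module ℂ W] (M : VOAModule A W)

/-- The homogeneous subspace `W_(α)`, `α ∈ ℂ`. -/
def weightSpace (α : ℂ) : Submodule ℂ W := (vmode M.Y A.omega 1).eigenspace α

/-- The decomposition of vectors of `W` into homogeneous components. -/
def decomp : W ≃ₗ[ℂ] ⨁ α : ℂ, M.weightSpace α :=
  (LinearEquiv.ofBijective (DirectSum.coeLinearMap M.weightSpace) M.grading.isInternal).symm

/-- The restricted dual `W' = ⨁ W_(α)^*`. -/
abbrev RestrictedDual : Type _ := ⨁ α : ℂ, Module.Dual ℂ (M.weightSpace α)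

/-- The pairing `⟨w', w⟩ = ∑ w'_α (w_α)` between `W'` and `W`. -/
def pairing : M.RestrictedDual →ₗ[ℂ] Module.Dual ℂ W :=
  DirectSum.toModule ℂ ℂ (Module.Dual ℂ W) (fun α =>
    (DirectSum.component ℂ ℂ (fun α => M.weightSpace α) α ∘ₗ M.decomp.toLinearMap).dualMap)

/-- `Y' : V → Hom(W', W'((z^{1/k})))` is given by the adjoint formula
`⟨Y'(v,z)w', w⟩ = ⟨w', Y_W(e^{z L(1)} e^{π i L(0)} z^{-2 L(0)} v, z⁻¹) w⟩`:
the coefficients of `z^q` of both sides agree for all rational `q`. On the right the coefficient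
`u_n` of `Y_W(u,z⁻¹)` comes with `z^(n+1)`; only finitely many terms are nonzero. -/
def IsAdjoint (k : ℕ) (Y' : V →ₗ[ℂ] VertexOperator ℂ M.RestrictedDual) : Prop :=
  ∀ (v : V) (w' : M.RestrictedDual) (w : W) (q : ℚ),
    M.pairing (fracCoeff k (Y' v) q w') w =
      ∑ᶠ n : ℤ, M.pairing w' (vmode M.Y (A.adjointArg v (q - (n + 1))) n w)

end VOAModule

end

/-!
The coefficient of `z^q` in `Y_W(e^{zL(1)} e^{πiL(0)} z^{-2L(0)} u, z⁻¹)`, for `u` of weight `α`, is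
`e^{πiα}` times the operator `∑ₛ (L(1)^s/s! u)_{a-s}` with `a = q + 2α - 1` when `a` is an integer,
and zero otherwise; this operator is `QGradedVOA.oppMode`. It shifts weights by `-α-q`, so it has a
transpose on the restricted dual (`VOAModule.dualMode`), and the lower truncation of `W` gives that
of `Y_{W'}`. The adjoint formula says precisely that these transposes are the coefficients of
`Y_{W'}` (`VOAModule.isAdjoint_iff`), whence existence and uniqueness. The powers of `z` that occur
lie in `-2α + ℤ`; this is where the monodromy `e^{4πiL(0)}` comes from.

The twisted Jacobi identity reduces to one for the operators `oppMode` on `W`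
(`QGradedVOA.oppMode_jacobi`), which is proved without change of formal variables.
* After expanding in the vectors `u⁽ˢ⁾ = L(1)^s/s! u` and `v⁽ᵗ⁾ = L(1)^t/t! v`, the left side is, for
  each pair `(s,t)`, up to sign the left side of the Jacobi identity of `W` for `u⁽ˢ⁾` and `v⁽ᵗ⁾`
  at shifted indices, with its two sums interchanged.
* The right side involves `L(1)^p/p! (u_n v)`. Moving `e^{L(1)}` past `Y(u,x)` expresses it by the
  vectors `u⁽ˢ⁾_m v⁽ᵗ⁾` (`QGradedVOA.expL1Coeff_vmode`); in terms of modes this is an induction on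
  `p` from the formula for `[L(1), u_n]` and a recursion of binomial coefficients.
* The coefficients on both sides then agree by the Chu–Vandermonde identity
  (`QGradedVOA.sum_choose_mul_conjCoeff`).

The operator `L(0)` of `W'` is the transpose of that of `W`, because `L(1)ω = 0`, so its eigenspaces
are the `W_(α)^*`.
-/

noncomputable section

open Filter Finset

/-! ### Finite sums and binomial coefficients -/

theorem hasFiniteSupport_of_eventually {X : Type*} [Zero X] {f : ℕ → X}
    (h : ∀ᶠ i in atTop, f i = 0) : Function.HasFiniteSupport f := by
  obtain ⟨N, hN⟩ := eventually_atTop.1 h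
  exact (Set.finite_lt_nat N).subset fun i hi => not_le.1 fun hNi => hi (hN i hNi)

theorem finsum_eq_sum_range {X : Type*} [AddCommMonoid X] {f : ℕ → X} {N : ℕ}
    (h : ∀ i, N ≤ i → f i = 0) : ∑ᶠ i, f i = ∑ i ∈ range N, f i :=
  finsum_eq_sum_of_support_subset f fun i hi => by
    simpa using not_le.1 fun hNi => hi (h i hNi)

/-- Summation along the antidiagonals of a box outside of which `f` vanishes. -/
theorem sum_range_sum_antidiagonal {X : Type*} [AddCommMonoid X] {f : ℕ × ℕ → X} {a b P : ℕ}
    (h₁ : ∀ i j, a ≤ i → f (i, j) = 0) (h₂ : ∀ i j, b ≤ j → f (i, j) = 0) (hP : a + b ≤ P) :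
    ∑ p ∈ range P, ∑ x ∈ antidiagonal p, f x = ∑ i ∈ range a, ∑ j ∈ range b, f (i, j) := by
  rw [← Finset.sum_product', ← Finset.sum_fiberwise_of_maps_to
    (s := range a ×ˢ range b) (t := range P) (g := fun x => x.1 + x.2)]
  · refine sum_congr rfl fun p _ => (sum_subset (fun x hx => ?_) fun x hx hx' => ?_).symm
    · simpa using (mem_filter.1 hx).2
    · rcases x with ⟨i, j⟩
      simp only [mem_filter, mem_product, mem_range, not_and] at hx'
      by_cases hi : a ≤ i
      · exact h₁ i j hi
      by_cases hj : b ≤ j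
      · exact h₂ i j hj
      · exact absurd (by simpa using hx) (hx' ⟨not_le.1 hi, not_le.1 hj⟩)
  · intro x hx
    simp only [mem_product, mem_range] at hx ⊢
    omega

theorem Ring.choose_neg_complex (x : ℂ) (n : ℕ) :
    Ring.choose (-x) n = (-1) ^ n * Ring.choose (x + n - 1) n := by
  rw [Ring.choose_neg, Units.smul_def, Int.coe_negOnePow_natCast, zsmul_eq_mul]
  push_cast
  rfl

theorem Ring.succ_mul_choose (x : ℂ) (n : ℕ) :
    ((n : ℂ) + 1) * Ring.choose (x + 1) (n + 1) = (x + 1) * Ring.choose x n := by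
  have h := Ring.choose_add_smul_choose x n 1
  simpa [Nat.choose_one_right, nsmul_eq_mul] using h

/-! ### Commutators of modes -/

section Modes

variable {V W : Type*} [AddCommGroup V] [Module ℂ V] [AddCommGroup W] [Module ℂ W]

theorem vmode_add (Y : V →ₗ[ℂ] VertexOperator ℂ W) (u v : V) (n : ℤ) :
    vmode Y (u + v) n = vmode Y u n + vmode Y v n := by
  simp [vmode]

theorem vmode_smul (Y : V →ₗ[ℂ] VertexOperator ℂ W) (c : ℂ) (v : V) (n : ℤ) :
    vmode Y (c • v) n = c • vmode Y v n := by
  simp [vmode]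

theorem vmode_zero (Y : V →ₗ[ℂ] VertexOperator ℂ W) (n : ℤ) : vmode Y 0 n = 0 := by
  simp [vmode]

theorem vmode_sum (Y : V →ₗ[ℂ] VertexOperator ℂ W) {ι : Type*} (s : Finset ι) (f : ι → V)
    (n : ℤ) : vmode Y (∑ i ∈ s, f i) n = ∑ i ∈ s, vmode Y (f i) n := by
  simp [vmode]

theorem eventually_vmode_eq_zero (Y : V →ₗ[ℂ] VertexOperator ℂ W) (u : V) (w : W) (l : ℤ) :
    ∀ᶠ i : ℕ in atTop, vmode Y u (l + i) w = 0 := by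
  set o := HahnSeries.order ((HahnModule.of ℂ).symm (Y u w))
  filter_upwards [eventually_ge_atTop (-l - o).toNat] with i hi
  exact VertexOperator.ncoeff_eq_zero_of_lt_order (Y u) (l + i) w (by omega)

theorem JacobiIdentity.eq {Y : V →ₗ[ℂ] VertexOperator ℂ V} {YW : V →ₗ[ℂ] VertexOperator ℂ W}
    (hJ : JacobiIdentity Y YW) (u v : V) (w : W) (l m n : ℤ) :
    (∑ᶠ i : ℕ, ((-1 : ℂ) ^ i * Ring.choose (l : ℂ) i) •
        vmode YW u (l + m - i) (vmode YW v (n + i) w))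
      - (∑ᶠ i : ℕ, ((-1 : ℂ) ^ (l + i) * Ring.choose (l : ℂ) i) •
        vmode YW v (l + n - i) (vmode YW u (m + i) w))
    = ∑ᶠ i : ℕ, Ring.choose (m : ℂ) i • vmode YW (vmode Y u (l + i) v) (m + n - i) w := by
  have h := hJ u v w l m n
  have e (z : ℤ) (i : ℕ) : ((Ring.choose z i : ℤ) : ℂ) = Ring.choose (z : ℂ) i :=
    Ring.map_choose (Int.castRingHom ℂ) z i
  simpa only [e] using h

/-- The commutator formula for a mode of nonnegative index. -/
theorem JacobiIdentity.commutator {Y : V →ₗ[ℂ] VertexOperator ℂ V}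
    {YW : V →ₗ[ℂ] VertexOperator ℂ W} (hJ : JacobiIdentity Y YW) (u v : V) (w : W)
    (m : ℕ) (n : ℤ) :
    vmode YW u m (vmode YW v n w) - vmode YW v n (vmode YW u m w) =
      ∑ i ∈ range (m + 1), (m.choose i : ℂ) • vmode YW (vmode Y u i v) (m + n - i) w := by
  have h := hJ.eq u v w 0 m n
  rw [finsum_eq_single _ 0, finsum_eq_single _ 0,
    finsum_eq_sum_range (N := m + 1)] at h
  · simpa [Ring.choose_natCast] using h
  · intro i hi
    simp [Ring.choose_natCast, Nat.choose_eq_zero_of_lt hi]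
  · intro i hi
    simp [Ring.choose_zero_pos ℂ (Nat.pos_of_ne_zero hi)]
  · intro i hi
    simp [Ring.choose_zero_pos ℂ (Nat.pos_of_ne_zero hi)]

/-- `Y_W(v_{-2}1, x) = d/dx Y_W(v, x)`, a consequence of the Jacobi identity and `Y_W(1,x) = 1`. -/
theorem JacobiIdentity.vmode_neg_two_one {Y : V →ₗ[ℂ] VertexOperator ℂ V}
    {YW : V →ₗ[ℂ] VertexOperator ℂ W} (hJ : JacobiIdentity Y YW) {one : V}
    (hone : ∀ n : ℤ, vmode YW one n = if n = -1 then 1 else 0) (v : V) (n : ℤ) :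
    vmode YW (vmode Y v (-2) one) n = (-(n : ℂ)) • vmode YW v (n - 1) := by
  ext w
  have h := hJ.eq v one w (-2) 0 n
  have hch (i : ℕ) : Ring.choose (((-2 : ℤ)) : ℂ) i = (-1) ^ i * (i + 1) := by
    have : (((-2 : ℤ)) : ℂ) = -2 := by norm_num
    rw [this, Ring.choose_neg_complex, show (2 : ℂ) + i - 1 = ((i + 1 : ℕ) : ℂ) by push_cast; ring,
      Ring.choose_natCast, Nat.choose_succ_self_right]
    push_cast; ring
  rw [finsum_eq_single (fun i : ℕ => Ring.choose (((0 : ℤ)) : ℂ) i • _) 0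
    (by intro i hi; simp [Ring.choose_zero_pos ℂ (Nat.pos_of_ne_zero hi)])] at h
  simp only [Nat.cast_zero, add_zero, zero_add, sub_zero, Ring.choose_zero_right, one_smul] at h
  rw [← h]
  simp only [hone, hch]
  -- exactly one of the two sums has a nonzero term, according to the sign of `n`
  rcases lt_or_ge n 0 with hn | hn
  · obtain ⟨k, rfl⟩ : ∃ k : ℕ, n = -1 - k := ⟨(-1 - n).toNat, by omega⟩
    rw [finsum_eq_single _ k, finsum_eq_single _ 0]
    · rw [if_pos (by omega), if_neg (by omega)]
      simp only [LinearMap.zero_apply, smul_zero, sub_zero, Module.End.one_apply,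
        LinearMap.smul_apply]
      congr 1
      · rw [← mul_assoc, ← mul_pow]; push_cast; norm_num
      · congr 2; ring
    · intro i _
      rw [if_neg (by omega)]; simp
    · intro i hi
      rw [if_neg (by omega)]; simp
  · rcases hn.eq_or_lt with rfl | hn
    · rw [finsum_eq_zero_of_forall_eq_zero, finsum_eq_zero_of_forall_eq_zero]
      · simp
      · intro i; rw [if_neg (by omega)]; simp
      · intro i; rw [if_neg (by omega)]; simp
    · obtain ⟨k, rfl⟩ : ∃ k : ℕ, n = k + 1 := ⟨(n - 1).toNat, by omega⟩
      rw [finsum_eq_zero_of_forall_eq_zero, finsum_eq_single _ k]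
      · rw [if_pos (by omega)]
        simp only [zero_sub, Module.End.one_apply, LinearMap.smul_apply]
        rw [← neg_smul]
        congr 1
        · rw [← mul_assoc, zpow_add₀ (by norm_num), zpow_natCast, mul_assoc ((-1 : ℂ) ^ (-2 : ℤ)),
            ← mul_pow]
          norm_num
        · congr 2; ring
      · intro i hi
        rw [if_neg (by omega)]; simp
      · intro i; rw [if_neg (by omega)]; simp

end Modes

namespace QGradedVOA

variable {V W : Type*} [AddCommGroup V] [Module ℂ V] [AddCommGroup W] [Module ℂ W]
  (A : QGradedVOA V)

theorem mem_weightSpace {α : ℚ} {v : V} : v ∈ A.weightSpace α ↔ A.L 0 v = (α : ℂ) • v :=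
  Module.End.mem_eigenspace_iff

theorem L_neg_one_eq (v : V) : A.L (-1) v = vmode A.Y v (-2) A.one := by
  have h := congrArg (fun f => f A.one) (A.derivative v (-1))
  simpa [A.creation_neg_one, L] using h

section Representation

variable {A} {YW : V →ₗ[ℂ] VertexOperator ℂ W} (hJ : JacobiIdentity A.Y YW)
  (hone : ∀ n : ℤ, vmode YW A.one n = if n = -1 then 1 else 0)

include hJ hone

theorem vmode_L_neg_one (v : V) (n : ℤ) :
    vmode YW (A.L (-1) v) n = (-(n : ℂ)) • vmode YW v (n - 1) := by
  rw [L_neg_one_eq, hJ.vmode_neg_two_one hone]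

theorem L_zero_vmode {α : ℚ} {u : V} (hu : u ∈ A.weightSpace α) (n : ℤ) (w : W) :
    vmode YW A.omega 1 (vmode YW u n w) =
      vmode YW u n (vmode YW A.omega 1 w) + ((α : ℂ) - n - 1) • vmode YW u n w := by
  have h := hJ.commutator A.omega u w 1 n
  have h₀ : vmode A.Y A.omega 0 u = A.L (-1) u := rfl
  have h₁ : vmode A.Y A.omega 1 u = (α : ℂ) • u := A.mem_weightSpace.1 hu
  rw [← sub_eq_iff_eq_add']
  refine h.trans ?_
  simp only [sum_range_succ, range_zero, sum_empty, Nat.cast_zero, Nat.cast_one, h₀, h₁,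
    vmode_L_neg_one hJ hone, vmode_smul, Nat.choose_self, Nat.choose_zero_right, one_smul, zero_add,
    LinearMap.smul_apply]
  rw [show (1 : ℤ) + n - 0 - 1 = n by ring, show (1 : ℤ) + n - 1 = n by ring, ← add_smul]
  congr 1
  push_cast; ring

theorem L_one_vmode {α : ℚ} {u : V} (hu : u ∈ A.weightSpace α) (n : ℤ) (w : W) :
    vmode YW A.omega 2 (vmode YW u n w) =
      vmode YW u n (vmode YW A.omega 2 w) + ((2 * α - n - 2 : ℂ) • vmode YW u (n + 1) w +
        vmode YW (A.L 1 u) n w) := by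
  have h := hJ.commutator A.omega u w 2 n
  have h₀ : vmode A.Y A.omega 0 u = A.L (-1) u := rfl
  have h₁ : vmode A.Y A.omega 1 u = (α : ℂ) • u := A.mem_weightSpace.1 hu
  have h₂ : vmode A.Y A.omega 2 u = A.L 1 u := rfl
  rw [← sub_eq_iff_eq_add']
  refine h.trans ?_
  simp only [sum_range_succ, range_zero, sum_empty, Nat.cast_zero, Nat.cast_one, Nat.cast_ofNat,
    h₀, h₁, h₂, vmode_L_neg_one hJ hone, vmode_smul, Nat.choose_self, Nat.choose_zero_right,
    Nat.choose_one_right, one_smul, zero_add, LinearMap.smul_apply]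
  rw [show (2 : ℤ) + n - 0 - 1 = n + 1 by ring, show (2 : ℤ) + n - 1 = n + 1 by ring,
    show (2 : ℤ) + n - 2 = n by ring, smul_smul, ← add_smul]
  congr 2
  push_cast; ring

end Representation

/-! ### Weights -/

theorem vmode_mem_weightSpace {α β : ℚ} {u v : V} (hu : u ∈ A.weightSpace α)
    (hv : v ∈ A.weightSpace β) (n : ℤ) : vmode A.Y u n v ∈ A.weightSpace (α + β - n - 1) := by
  rw [mem_weightSpace] at hv ⊢
  have h := L_zero_vmode A.jacobi A.vacuum hu n v
  change vmode A.Y A.omega 1 v = _ at hv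
  change vmode A.Y A.omega 1 _ = _
  rw [h, hv, map_smul, ← add_smul]
  congr 1
  push_cast; ring

theorem L_one_mem_weightSpace {α : ℚ} {v : V} (hv : v ∈ A.weightSpace α) :
    A.L 1 v ∈ A.weightSpace (α - 1) := by
  rw [mem_weightSpace] at hv ⊢
  have h := congrArg (fun f => f v) (A.virasoro 0 1)
  change A.L 0 (A.L 1 v) - A.L 1 (A.L 0 v) = _ at h
  rw [hv, map_smul, sub_eq_iff_eq_add] at h
  rw [h]
  simp only [zero_add, Int.cast_zero, Int.cast_one, if_neg one_ne_zero, zero_smul, add_zero,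
    LinearMap.smul_apply]
  change (0 - 1 : ℂ) • A.L 1 v + _ = _
  rw [← add_smul]
  congr 1
  push_cast; ring

theorem one_mem_weightSpace : A.one ∈ A.weightSpace 0 := by
  rw [mem_weightSpace]
  simpa [L] using A.creation A.omega 1 (by norm_num)

theorem L_one_one : A.L 1 A.one = 0 := A.creation A.omega 2 (by norm_num)

theorem L_neg_two_one : A.L (-2) A.one = A.omega := A.creation_neg_one A.omega

theorem omega_mem_weightSpace : A.omega ∈ A.weightSpace 2 := by
  rw [mem_weightSpace]
  have h := congrArg (fun f => f A.one) (A.virasoro 0 (-2))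
  change A.L 0 (A.L (-2) A.one) - A.L (-2) (A.L 0 A.one) = _ at h
  rw [A.mem_weightSpace.1 A.one_mem_weightSpace, L_neg_two_one] at h
  simp only [Rat.cast_zero, zero_smul, map_zero, sub_zero] at h
  rw [h]
  simp [A.creation_neg_one]

theorem L_one_omega : A.L 1 A.omega = 0 := by
  have h := congrArg (fun f => f A.one) (A.virasoro 1 (-2))
  change A.L 1 (A.L (-2) A.one) - A.L (-2) (A.L 1 A.one) = _ at h
  rw [L_one_one, L_neg_two_one] at h
  simp only [map_zero, sub_zero] at h
  rw [h]
  simp [A.creation A.omega 0 le_rfl]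

/-! ### The exponential of `L(1)` -/

/-- The coefficient `L(1)^s / s!` of `z^s` in `e^{zL(1)}`. -/
def expL1Coeff (s : ℕ) : Module.End ℂ V := ((s.factorial : ℂ)⁻¹) • (A.L 1) ^ s

theorem expL1Coeff_zero : A.expL1Coeff 0 = 1 := by simp [expL1Coeff]

theorem L_one_expL1Coeff (s : ℕ) (v : V) :
    A.L 1 (A.expL1Coeff s v) = ((s : ℂ) + 1) • A.expL1Coeff (s + 1) v := by
  simp only [expL1Coeff, LinearMap.smul_apply, map_smul, smul_smul, pow_succ', Module.End.mul_apply]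
  congr 1
  rw [Nat.factorial_succ]
  have : (s.factorial : ℂ) ≠ 0 := by exact_mod_cast s.factorial_ne_zero
  have : (s : ℂ) + 1 ≠ 0 := by exact_mod_cast s.succ_ne_zero
  push_cast; field_simp

theorem expL1Coeff_mem_weightSpace {α : ℚ} {v : V} (hv : v ∈ A.weightSpace α) (s : ℕ) :
    A.expL1Coeff s v ∈ A.weightSpace (α - s) := by
  refine Submodule.smul_mem _ _ ?_
  induction s with
  | zero => simpa using hv
  | succ s ih =>
    rw [pow_succ', Module.End.mul_apply]
    convert A.L_one_mem_weightSpace ih using 2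
    push_cast; ring

theorem expL1Coeff_of_L_one_eq_zero {v : V} (hv : A.L 1 v = 0) {s : ℕ} (hs : s ≠ 0) :
    A.expL1Coeff s v = 0 := by
  obtain ⟨t, rfl⟩ := Nat.exists_eq_succ_of_ne_zero hs
  simp [expL1Coeff, pow_succ, hv]

/-! ### Homogeneous components -/

theorem proj_apply (α : ℚ) (v : V) : A.proj α v = (A.decomp v α : V) := rfl

theorem proj_mem (α : ℚ) (v : V) : A.proj α v ∈ A.weightSpace α := (A.decomp v α).2

theorem sum_support_proj (v : V) : ∃ s : Finset ℚ, (∀ α ∉ s, A.proj α v = 0) ∧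
    v = ∑ α ∈ s, A.proj α v := by
  classical
  refine ⟨(A.decomp v).support, fun α hα => ?_, ?_⟩
  · rw [proj_apply, DFinsupp.notMem_support_iff.1 hα]; rfl
  · conv_lhs => rw [← A.decomp.symm_apply_apply v]
    exact DirectSum.coeLinearMap_eq_dfinsuppSum _ (A.decomp v)

theorem decomp_of_mem {α : ℚ} {v : V} (hv : v ∈ A.weightSpace α) :
    A.decomp v = DirectSum.lof ℂ ℚ (fun α => A.weightSpace α) α ⟨v, hv⟩ := by
  exact (LinearEquiv.symm_apply_eq _).2
    (DirectSum.coeLinearMap_lof A.weightSpace α ⟨v, hv⟩).symm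

theorem proj_of_mem {α : ℚ} {v : V} (hv : v ∈ A.weightSpace α) (β : ℚ) :
    A.proj β v = if β = α then v else 0 := by
  rw [proj_apply, A.decomp_of_mem hv, DirectSum.lof_eq_of]
  split_ifs with h
  · subst h; rw [DirectSum.of_eq_same]
  · rw [DirectSum.of_eq_of_ne _ _ _ h]; rfl

theorem expL0_of_mem {α : ℚ} {v : V} (hv : v ∈ A.weightSpace α) (s : ℂ) :
    A.expL0 s v = Complex.exp (s * α) • v := by
  simp [expL0, A.decomp_of_mem hv]

@[elab_as_elim]
theorem induction_weight {P : V → Prop} (v : V) (zero : P 0)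
    (add : ∀ u v, P u → P v → P (u + v)) (weight : ∀ α, ∀ v ∈ A.weightSpace α, P v) : P v := by
  obtain ⟨s, -, hv⟩ := A.sum_support_proj v
  rw [hv]
  exact Finset.sum_induction _ P add zero fun α _ => weight α _ (A.proj_mem α v)

theorem eventually_expL1Coeff_eq_zero (v : V) : ∀ᶠ s in atTop, A.expL1Coeff s v = 0 := by
  induction v using A.induction_weight with
  | zero => simp
  | add u v hu hv => filter_upwards [hu, hv] with s h₁ h₂; simp [h₁, h₂]
  | weight α v hv =>
    obtain ⟨N, hN⟩ := A.truncated
    filter_upwards [eventually_gt_atTop ⌈α - N⌉₊] with s hs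
    have h := A.expL1Coeff_mem_weightSpace hv s
    have hlt : α - s < N := by linarith [Nat.lt_of_ceil_lt hs]
    rw [weightSpace, hN _ hlt] at h
    simpa using h

/-! ### Conjugation by `e^{L(1)}` -/

/-- The coefficient of `x^j` in `(1-x)^{p+j+1-2α+i}`. It is the coefficient of
`(L(1)^i/i! u)_{p+j}` when `e^{L(1)}` is moved past `u_p`, for `u` of weight `α`; see
`expL1Coeff_vmode`. -/
def conjCoeff (α : ℚ) (p : ℤ) (i j : ℕ) : ℂ :=
  (-1) ^ j * Ring.choose ((p : ℂ) + j + 1 - 2 * α + i) j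

theorem conjCoeff_zero (α : ℚ) (p : ℤ) (i : ℕ) : conjCoeff α p i 0 = 1 := by
  simp [conjCoeff]

theorem conjCoeff_rec_left (α : ℚ) (p : ℤ) (i j : ℕ) :
    ((i : ℂ) + 1 + (j + 1)) * conjCoeff α p (i + 1) (j + 1) =
      (2 * α - 2 * (i + 1) - p - j - 2) * conjCoeff α p (i + 1) j +
        (i + 1) * conjCoeff α p i (j + 1) := by
  set X : ℂ := (p : ℂ) + j + 1 - 2 * α + (i + 1) with hX
  have e₁ : conjCoeff α p (i + 1) (j + 1) = (-1) ^ (j + 1) * Ring.choose (X + 1) (j + 1) := by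
    unfold conjCoeff; congr 2; push_cast; ring
  have e₂ : conjCoeff α p (i + 1) j = (-1) ^ j * Ring.choose X j := by
    unfold conjCoeff; congr 2; push_cast; ring
  have e₃ : conjCoeff α p i (j + 1) = (-1) ^ (j + 1) * Ring.choose X (j + 1) := by
    unfold conjCoeff; congr 2; push_cast; ring
  have h₁ := Ring.succ_mul_choose X j
  have h₂ := Ring.choose_succ_succ X j
  rw [e₁, e₂, e₃, pow_succ]
  have : (2 * α - 2 * ((i : ℂ) + 1) - p - j - 2) = -(X + 1) - (i + 1) := by rw [hX]; ring
  rw [this]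
  linear_combination (-(-1) ^ j) * h₁ - (-1) ^ j * ((i : ℂ) + 1) * h₂

theorem conjCoeff_rec_right (α : ℚ) (p : ℤ) (j : ℕ) :
    ((j : ℂ) + 1) * conjCoeff α p 0 (j + 1) = (2 * α - p - j - 2) * conjCoeff α p 0 j := by
  have h₁ := Ring.succ_mul_choose ((p : ℂ) + j + 1 - 2 * α) j
  unfold conjCoeff
  push_cast
  simp only [add_zero]
  rw [show (p : ℂ) + (j + 1) + 1 - 2 * α = (p : ℂ) + j + 1 - 2 * α + 1 by ring, pow_succ]
  linear_combination (-(-1) ^ j) * h₁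

/-- The modes form of `e^{L(1)} Y(u,x) e^{-L(1)} = Y(e^{(1-x)L(1)} (1-x)^{-2L(0)} u, x/(1-x))`. -/
theorem expL1Coeff_vmode {α : ℚ} {u : V} (hu : u ∈ A.weightSpace α) (v : V) (p : ℤ) (m : ℕ) :
    A.expL1Coeff m (vmode A.Y u p v) = ∑ x ∈ antidiagonal m, ∑ y ∈ antidiagonal x.1,
      conjCoeff α p y.1 y.2 •
        vmode A.Y (A.expL1Coeff y.1 u) (p + y.2) (A.expL1Coeff x.2 v) := by
  induction m with
  | zero => simp [conjCoeff_zero, expL1Coeff_zero]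
  | succ m ih =>
    set G : ℕ → ℕ → ℕ → V := fun i j t =>
      vmode A.Y (A.expL1Coeff i u) (p + j) (A.expL1Coeff t v) with hG
    have hm : (m : ℂ) + 1 ≠ 0 := by exact_mod_cast m.succ_ne_zero
    have hL (i j t : ℕ) : A.L 1 (G i j t) = ((t : ℂ) + 1) • G i j (t + 1) +
        ((2 * α - 2 * i - p - j - 2 : ℂ) • G i (j + 1) t + ((i : ℂ) + 1) • G (i + 1) j t) := by
      have h := L_one_vmode A.jacobi A.vacuum (A.expL1Coeff_mem_weightSpace hu i) (p + j)
        (A.expL1Coeff t v)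
      have h₂ (x : V) : vmode A.Y A.omega 2 x = A.L 1 x := rfl
      simp only [h₂, L_one_expL1Coeff, vmode_smul, map_smul, LinearMap.smul_apply] at h
      rw [hG]
      dsimp only
      rw [h]
      congr 3
      · push_cast; ring
      · congr 1; rw [Nat.cast_succ, add_assoc]
    -- the terms in which `L(1)` acts on the mode of `u`, collected by their total degree `a + 1`
    have hZ (a t : ℕ) : ∑ y ∈ antidiagonal (a + 1),
          (((y.1 : ℂ) + y.2) * conjCoeff α p y.1 y.2) • G y.1 y.2 t =
        ∑ y ∈ antidiagonal a, conjCoeff α p y.1 y.2 •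
          ((2 * α - 2 * y.1 - p - y.2 - 2 : ℂ) • G y.1 (y.2 + 1) t +
            ((y.1 : ℂ) + 1) • G (y.1 + 1) y.2 t) := by
      have e (i j : ℕ) : ((i : ℂ) + j) * conjCoeff α p i j =
          (if j = 0 then 0 else
            (2 * α - 2 * i - p - (j - 1 : ℕ) - 2) * conjCoeff α p i (j - 1)) +
          (if i = 0 then 0 else (i : ℂ) * conjCoeff α p (i - 1) j) := by
        rcases i with _ | i <;> rcases j with _ | j
        · simp
        · simpa using conjCoeff_rec_right α p j
        · simp [conjCoeff_zero]
        · simpa using conjCoeff_rec_left α p i j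
      simp only [smul_add, smul_smul]
      simp only [e, add_smul, sum_add_distrib]
      rw [Nat.sum_antidiagonal_succ', Nat.sum_antidiagonal_succ]
      simp [mul_comm]
    have key : A.L 1 (A.expL1Coeff m (vmode A.Y u p v)) = ((m : ℂ) + 1) •
        ∑ x ∈ antidiagonal (m + 1), ∑ y ∈ antidiagonal x.1,
          conjCoeff α p y.1 y.2 • G y.1 y.2 x.2 := by
      rw [ih]
      simp only [map_sum, map_smul]
      calc
        _ = (∑ x ∈ antidiagonal m, ∑ y ∈ antidiagonal x.1,
              conjCoeff α p y.1 y.2 • ((x.2 : ℂ) + 1) • G y.1 y.2 (x.2 + 1)) +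
            ∑ x ∈ antidiagonal m, ∑ y ∈ antidiagonal (x.1 + 1),
              (((y.1 : ℂ) + y.2) * conjCoeff α p y.1 y.2) • G y.1 y.2 x.2 := by
          simp only [hZ, ← sum_add_distrib, ← smul_add]
          exact sum_congr rfl fun x _ => sum_congr rfl fun y _ => congrArg _ (hL _ _ _)
        _ = (∑ x ∈ antidiagonal (m + 1), ∑ y ∈ antidiagonal x.1,
              conjCoeff α p y.1 y.2 • (x.2 : ℂ) • G y.1 y.2 x.2) +
            ∑ x ∈ antidiagonal (m + 1), ∑ y ∈ antidiagonal x.1,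
              (((y.1 : ℂ) + y.2) * conjCoeff α p y.1 y.2) • G y.1 y.2 x.2 := by
          congr 1
          · rw [Nat.sum_antidiagonal_succ']; simp
          · rw [Nat.sum_antidiagonal_succ]; simp
        _ = _ := by
          rw [← sum_add_distrib, smul_sum]
          refine sum_congr rfl fun x hx => ?_
          rw [← sum_add_distrib, smul_sum]
          refine sum_congr rfl fun y hy => ?_
          have h₁ : (m : ℂ) + 1 = y.1 + y.2 + x.2 := by
            have := mem_antidiagonal.1 hx
            have := mem_antidiagonal.1 hy
            norm_cast; omega
          rw [h₁, smul_smul, smul_smul, ← add_smul]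
          congr 1
          ring
    rw [L_one_expL1Coeff] at key
    exact smul_right_injective V hm key

end QGradedVOA

/-! ### The modes of the opposite vertex operator -/

namespace QGradedVOA

variable {V W : Type*} [AddCommGroup V] [Module ℂ V] [AddCommGroup W] [Module ℂ W]
  (A : QGradedVOA V)

theorem finsum_sum_sum_comm {X : Type*} [AddCommMonoid X] (s t : Finset ℕ) (f : ℕ → ℕ → ℕ → X)
    (hf : ∀ a b, ∀ᶠ i in atTop, f a b i = 0) :
    ∑ᶠ i, ∑ a ∈ s, ∑ b ∈ t, f a b i = ∑ a ∈ s, ∑ b ∈ t, ∑ᶠ i, f a b i := by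
  rw [finsum_sum_comm]
  · exact sum_congr rfl fun a _ => finsum_sum_comm _ _ fun b _ =>
      hasFiniteSupport_of_eventually (hf a b)
  · intro a _
    refine hasFiniteSupport_of_eventually ?_
    filter_upwards [(eventually_all_finset t).2 fun b _ => hf a b] with i hi
    exact sum_eq_zero hi

/-- The operator `∑ₛ (L(1)^s/s! u)_{a-s}` on a module. For `u` of weight `α`, it is up to the scalar
`e^{πiα}` the coefficient of `z^{a+1-2α}` in `Y_W(e^{zL(1)} e^{πiL(0)} z^{-2L(0)} u, z⁻¹)`. -/
def oppMode (YW : V →ₗ[ℂ] VertexOperator ℂ W) (u : V) (a : ℤ) : Module.End ℂ W :=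
  ∑ᶠ s : ℕ, vmode YW (A.expL1Coeff s u) (a - s)

theorem exists_expL1Coeff_eq_zero (u v : V) : ∃ S : ℕ, ∀ s, S ≤ s →
    A.expL1Coeff s u = 0 ∧ A.expL1Coeff s v = 0 :=
  eventually_atTop.1 ((A.eventually_expL1Coeff_eq_zero u).and (A.eventually_expL1Coeff_eq_zero v))

variable {A}

theorem oppMode_eq_sum {u : V} {S : ℕ} (h : ∀ s, S ≤ s → A.expL1Coeff s u = 0)
    (YW : V →ₗ[ℂ] VertexOperator ℂ W) (a : ℤ) :
    A.oppMode YW u a = ∑ s ∈ range S, vmode YW (A.expL1Coeff s u) (a - s) :=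
  finsum_eq_sum_range fun s hs => by rw [h s hs, vmode_zero]

theorem oppMode_zero (YW : V →ₗ[ℂ] VertexOperator ℂ W) (a : ℤ) : A.oppMode YW 0 a = 0 := by
  rw [oppMode_eq_sum (S := 0) (by simp)]; simp

theorem vmode_finite_bound (u v : V) (l : ℤ) : ∃ I : ℕ, ∀ k, I ≤ k → ∀ s t,
    vmode A.Y (A.expL1Coeff s u) (l + k) (A.expL1Coeff t v) = 0 := by
  obtain ⟨S, hS⟩ := A.exists_expL1Coeff_eq_zero u v
  have h : ∀ᶠ k : ℕ in atTop, ∀ x ∈ range S ×ˢ range S,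
      vmode A.Y (A.expL1Coeff x.1 u) (l + k) (A.expL1Coeff x.2 v) = 0 :=
    (eventually_all_finset _).2 fun x _ => eventually_vmode_eq_zero _ _ _ _
  obtain ⟨I, hI⟩ := eventually_atTop.1 h
  refine ⟨I, fun k hk s t => ?_⟩
  by_cases hs : S ≤ s
  · rw [(hS s hs).1, vmode_zero, LinearMap.zero_apply]
  by_cases ht : S ≤ t
  · rw [(hS t ht).2, map_zero]
  · exact hI k hk (s, t) (by simpa using And.intro (not_le.1 hs) (not_le.1 ht))

/-- The opposite modes of `u_p v`, through the conjugation formula `expL1Coeff_vmode`. -/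
theorem oppMode_vmode {α : ℚ} {u v : V} (hu : u ∈ A.weightSpace α) {S I : ℕ} {p : ℤ}
    (hS : ∀ s, S ≤ s → A.expL1Coeff s u = 0 ∧ A.expL1Coeff s v = 0)
    (hI : ∀ j : ℕ, I ≤ j → ∀ s t,
      vmode A.Y (A.expL1Coeff s u) (p + j) (A.expL1Coeff t v) = 0)
    (YW : V →ₗ[ℂ] VertexOperator ℂ W) (e : ℤ) :
    A.oppMode YW (vmode A.Y u p v) e = ∑ s ∈ range S, ∑ t ∈ range S, ∑ j ∈ range I,
      conjCoeff α p s j • vmode YW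
        (vmode A.Y (A.expL1Coeff s u) (p + j) (A.expL1Coeff t v)) (e - s - t - j) := by
  set g : ℕ → ℕ → ℕ → V := fun s j t =>
    vmode A.Y (A.expL1Coeff s u) (p + j) (A.expL1Coeff t v) with hg
  have g₁ (s j t : ℕ) (h : S ≤ s) : g s j t = 0 := by
    rw [hg]; dsimp only; rw [(hS s h).1, vmode_zero, LinearMap.zero_apply]
  have g₂ (s j t : ℕ) (h : I ≤ j) : g s j t = 0 := hI j h s t
  have g₃ (s j t : ℕ) (h : S ≤ t) : g s j t = 0 := by
    rw [hg]; dsimp only; rw [(hS t h).2, map_zero]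
  have g₁₂ (a t : ℕ) (ha : S + I ≤ a) (y : ℕ × ℕ) (hy : y ∈ antidiagonal a) :
      g y.1 y.2 t = 0 := by
    have := mem_antidiagonal.1 hy
    rcases le_or_gt S y.1 with h | h
    · exact g₁ _ _ _ h
    · exact g₂ _ _ _ (by omega)
  rw [oppMode_eq_sum (S := S + I + S)]
  · have hterm (q : ℕ) : vmode YW (A.expL1Coeff q (vmode A.Y u p v)) (e - q) =
        ∑ x ∈ antidiagonal q, ∑ y ∈ antidiagonal x.1,
          conjCoeff α p y.1 y.2 • vmode YW (g y.1 y.2 x.2) (e - y.1 - x.2 - y.2) := by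
      rw [A.expL1Coeff_vmode hu]
      simp only [vmode_sum, vmode_smul]
      refine sum_congr rfl fun x hx => sum_congr rfl fun y hy => ?_
      have h₁ := mem_antidiagonal.1 hx
      have h₂ := mem_antidiagonal.1 hy
      rw [show e - (q : ℤ) = e - y.1 - x.2 - y.2 by omega]
    simp only [hterm]
    rw [sum_range_sum_antidiagonal (a := S + I) (b := S) _ _ le_rfl, sum_comm]
    · rw [sum_comm (s := range S) (t := range S)]
      refine sum_congr rfl fun t _ => ?_
      exact sum_range_sum_antidiagonal
        (f := fun y => conjCoeff α p y.1 y.2 • vmode YW (g y.1 y.2 t) (e - y.1 - t - y.2))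
        (fun i j hi => by dsimp only; rw [g₁ _ _ _ hi, vmode_zero, smul_zero])
        (fun i j hj => by dsimp only; rw [g₂ _ _ _ hj, vmode_zero, smul_zero]) le_rfl
    · intro i j hi
      exact sum_eq_zero fun y hy => by rw [g₁₂ _ _ hi y hy, vmode_zero, smul_zero]
    · intro i j hj
      exact sum_eq_zero fun y hy => by rw [g₃ _ _ _ hj, vmode_zero, smul_zero]
  · intro q hq
    rw [A.expL1Coeff_vmode hu]
    refine sum_eq_zero fun x hx => sum_eq_zero fun y hy => ?_
    have := mem_antidiagonal.1 hx
    rcases le_or_gt S x.2 with h | h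
    · exact (congrArg _ (g₃ _ _ _ h)).trans (smul_zero _)
    · exact (congrArg _ (g₁₂ x.1 x.2 (by omega) y hy)).trans (smul_zero _)

/-- The instance of the Chu–Vandermonde identity that matches the two sides of `oppMode_jacobi`. -/
theorem sum_choose_mul_conjCoeff (α : ℚ) (l a : ℤ) (s k : ℕ) :
    ∑ x ∈ antidiagonal k, (-1 : ℂ) ^ (l + 1 + x.1) * Ring.choose (2 * α - a - l - 2 : ℂ) x.1 *
        conjCoeff α (l + x.1) s x.2 =
      -(-1) ^ l * Ring.choose (((a - s : ℤ)) : ℂ) k := by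
  have h := Ring.add_choose_eq (r := (2 * α - a - l - 2 : ℂ))
    (s := (l : ℂ) + k + 1 - 2 * α + s) k (Commute.all _ _)
  rw [show (((a - s : ℤ)) : ℂ) = -((s : ℂ) - a) by push_cast; ring, Ring.choose_neg_complex,
    show (s : ℂ) - a + k - 1 = (2 * α - a - l - 2 : ℂ) + ((l : ℂ) + k + 1 - 2 * α + s) by ring, h,
    mul_sum, mul_sum]
  refine sum_congr rfl fun x hx => ?_
  have hk := mem_antidiagonal.1 hx
  rw [conjCoeff, show (((l + x.1 : ℤ)) : ℂ) + x.2 + 1 - 2 * α + s =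
    (l : ℂ) + k + 1 - 2 * α + s by rw [← hk]; push_cast; ring, ← hk, pow_add,
    zpow_add₀ (by norm_num), zpow_add₀ (by norm_num), zpow_natCast, zpow_one]
  ring

/-- The Jacobi identity for the opposite modes. For each pair of vectors `L(1)^s/s! u`,
`L(1)^t/t! v` the left side is `-(-1)^l` times the left side of the Jacobi identity on `W` with
indices `l`, `a - s`, `b - t`. The upper entry `2α - a - l - 2` of the binomial coefficients on the
right is the rational index `m` of `u` in the twisted Jacobi identity. -/
theorem oppMode_jacobi {YW : V →ₗ[ℂ] VertexOperator ℂ W} (hJ : JacobiIdentity A.Y YW)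
    {α : ℚ} {u : V} (hu : u ∈ A.weightSpace α) (v : V) (w : W) (l a b : ℤ) :
    (∑ᶠ i : ℕ, ((-1 : ℂ) ^ i * Ring.choose (l : ℂ) i) •
        A.oppMode YW v (b + l - i) (A.oppMode YW u (a + i) w))
      - (∑ᶠ i : ℕ, ((-1 : ℂ) ^ (l + i) * Ring.choose (l : ℂ) i) •
        A.oppMode YW u (a + l - i) (A.oppMode YW v (b + i) w))
    = ∑ᶠ i : ℕ, ((-1 : ℂ) ^ (l + 1 + i) * Ring.choose (2 * α - a - l - 2 : ℂ) i) •
        A.oppMode YW (vmode A.Y u (l + i) v) (a + b - i) w := by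
  obtain ⟨S, hS⟩ := A.exists_expL1Coeff_eq_zero u v
  obtain ⟨I, hI⟩ := vmode_finite_bound (A := A) u v l
  set U := fun s => A.expL1Coeff s u with hU
  set T := fun t => A.expL1Coeff t v with hT
  have hu' := oppMode_eq_sum (fun s hs => (hS s hs).1) YW
  have hv' := oppMode_eq_sum (fun s hs => (hS s hs).2) YW
  have hc (i : ℕ) : (-1 : ℂ) ^ l * (-1) ^ (l + i) = (-1) ^ i := by
    rw [zpow_add₀ (by norm_num), ← mul_assoc, ← mul_zpow, zpow_natCast]; norm_num
  have h₁ : (∑ᶠ i : ℕ, ((-1 : ℂ) ^ i * Ring.choose (l : ℂ) i) •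
      A.oppMode YW v (b + l - i) (A.oppMode YW u (a + i) w)) =
      ∑ s ∈ range S, ∑ t ∈ range S, (-1 : ℂ) ^ l •
        ∑ᶠ i : ℕ, ((-1 : ℂ) ^ (l + i) * Ring.choose (l : ℂ) i) •
          vmode YW (T t) (l + (b - t) - i) (vmode YW (U s) ((a - s) + i) w) := by
    simp only [smul_finsum]
    rw [← finsum_sum_sum_comm]
    · refine finsum_congr fun i => ?_
      rw [hu', hv', LinearMap.sum_apply, smul_sum]
      simp only [LinearMap.sum_apply, smul_sum, map_sum, smul_smul, ← mul_assoc]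
      rw [sum_comm]
      refine sum_congr rfl fun s _ => sum_congr rfl fun t _ => ?_
      rw [hc, show b + l - (i : ℤ) - t = l + (b - t) - i by ring,
        show a + (i : ℤ) - s = a - s + i by ring]
    · intro s t
      exact (eventually_vmode_eq_zero YW (U s) w (a - s)).mono fun i hi => by rw [hi]; simp
  have h₂ : (∑ᶠ i : ℕ, ((-1 : ℂ) ^ (l + i) * Ring.choose (l : ℂ) i) •
      A.oppMode YW u (a + l - i) (A.oppMode YW v (b + i) w)) =
      ∑ s ∈ range S, ∑ t ∈ range S, (-1 : ℂ) ^ l •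
        ∑ᶠ i : ℕ, ((-1 : ℂ) ^ i * Ring.choose (l : ℂ) i) •
          vmode YW (U s) (l + (a - s) - i) (vmode YW (T t) ((b - t) + i) w) := by
    simp only [smul_finsum]
    rw [← finsum_sum_sum_comm]
    · refine finsum_congr fun i => ?_
      rw [hu', hv', LinearMap.sum_apply, smul_sum]
      simp only [LinearMap.sum_apply, smul_sum, map_sum, smul_smul, ← mul_assoc]
      refine sum_congr rfl fun s _ => sum_congr rfl fun t _ => ?_
      rw [zpow_add₀ (by norm_num), zpow_natCast,
        show a + l - (i : ℤ) - s = l + (a - s) - i by ring,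
        show b + (i : ℤ) - t = b - t + i by ring]
    · intro s t
      exact (eventually_vmode_eq_zero YW (T t) w (b - t)).mono fun i hi => by rw [hi]; simp
  set F : ℕ → ℕ → ℕ → W := fun s t k =>
    vmode YW (vmode A.Y (U s) (l + k) (T t)) (a + b - s - t - k) w with hF
  have hF₀ (s t k : ℕ) (hk : I ≤ k) : F s t k = 0 := by
    rw [hF]; dsimp only; rw [hI k hk, vmode_zero, LinearMap.zero_apply]
  have h₃ (s t : ℕ) : (-1 : ℂ) ^ l • (∑ᶠ i : ℕ, ((-1 : ℂ) ^ (l + i) * Ring.choose (l : ℂ) i) •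
        vmode YW (T t) (l + (b - t) - i) (vmode YW (U s) ((a - s) + i) w)) -
      (-1 : ℂ) ^ l • (∑ᶠ i : ℕ, ((-1 : ℂ) ^ i * Ring.choose (l : ℂ) i) •
        vmode YW (U s) (l + (a - s) - i) (vmode YW (T t) ((b - t) + i) w)) =
      ∑ k ∈ range (I + I), (-(-1) ^ l * Ring.choose (((a - s : ℤ)) : ℂ) k) • F s t k := by
    rw [← smul_sub, ← neg_sub, hJ.eq (U s) (T t) w l (a - s) (b - t),
      finsum_eq_sum_range (N := I + I), smul_neg, ← neg_smul, smul_sum]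
    · refine sum_congr rfl fun k _ => ?_
      rw [smul_smul, show a - s + (b - t) - (k : ℤ) = a + b - s - t - k by ring]
    · intro k hk
      rw [hI k (by omega), vmode_zero, LinearMap.zero_apply, smul_zero]
  rw [h₁, h₂]
  simp only [← sum_sub_distrib, h₃, ← sum_choose_mul_conjCoeff α, sum_smul]
  rw [finsum_eq_sum_range (N := I)]
  · have h₄ (i : ℕ) : A.oppMode YW (vmode A.Y u (l + i) v) (a + b - i) w =
        ∑ s ∈ range S, ∑ t ∈ range S, ∑ j ∈ range I,
          conjCoeff α (l + i) s j • F s t (i + j) := by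
      rw [oppMode_vmode hu hS (I := I)
        (fun j hj s t => by rw [add_assoc]; exact_mod_cast hI (i + j) (by omega) s t)]
      simp only [LinearMap.sum_apply, LinearMap.smul_apply]
      refine sum_congr rfl fun s _ => sum_congr rfl fun t _ => sum_congr rfl fun j _ => ?_
      rw [hF]
      dsimp only
      rw [show a + b - (i : ℤ) - s - t - j = a + b - s - t - (i + j : ℕ) by push_cast; ring,
        show l + (i : ℤ) + j = l + (i + j : ℕ) by push_cast; ring]
    simp only [h₄, smul_sum]
    symm
    rw [sum_comm]
    refine sum_congr rfl fun s _ => ?_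
    rw [sum_comm]
    refine sum_congr rfl fun t _ => ?_
    rw [← sum_range_sum_antidiagonal (f := fun x => ((-1 : ℂ) ^ (l + 1 + x.1) *
      Ring.choose (2 * α - a - l - 2 : ℂ) x.1) • conjCoeff α (l + x.1) s x.2 • F s t (x.1 + x.2))
      (a := I) (b := I) _ _ le_rfl]
    · refine sum_congr rfl fun k _ => sum_congr rfl fun x hx => ?_
      rw [smul_smul, ← mem_antidiagonal.1 hx]
    · intro i j hi
      dsimp only
      rw [hF₀ _ _ _ (by omega), smul_zero, smul_zero]
    · intro i j hj
      dsimp only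
      rw [hF₀ _ _ _ (by omega), smul_zero, smul_zero]
  · intro i hi
    have h₅ : vmode A.Y u (l + i) v = 0 := by
      simpa [expL1Coeff_zero] using hI i hi 0 0
    rw [h₅, oppMode_zero, LinearMap.zero_apply, smul_zero]

end QGradedVOA

/-! ### The adjoint operators on a module -/

namespace QGradedVOA

variable {V W : Type*} [AddCommGroup V] [Module ℂ V] [AddCommGroup W] [Module ℂ W]
  {A : QGradedVOA V}

theorem eventually_oppMode_eq_zero (YW : V →ₗ[ℂ] VertexOperator ℂ W) (u : V) (w : W) (a : ℤ) :
    ∀ᶠ i : ℕ in atTop, A.oppMode YW u (a + i) w = 0 := by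
  obtain ⟨S, hS⟩ := A.exists_expL1Coeff_eq_zero u u
  filter_upwards [(eventually_all_finset (range S)).2 fun s _ =>
    eventually_vmode_eq_zero YW (A.expL1Coeff s u) w (a - s)] with i hi
  rw [oppMode_eq_sum fun s hs => (hS s hs).1, LinearMap.sum_apply]
  exact sum_eq_zero fun s hs => by rw [show a + (i : ℤ) - s = a - s + i by ring, hi s hs]

theorem oppMode_of_L_one_eq_zero {u : V} (hu : A.L 1 u = 0) (YW : V →ₗ[ℂ] VertexOperator ℂ W)
    (a : ℤ) : A.oppMode YW u a = vmode YW u a := by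
  rw [oppMode_eq_sum (S := 1) fun s hs => A.expL1Coeff_of_L_one_eq_zero hu (by omega)]
  simp [expL1Coeff_zero]

variable (A) in
theorem adjointArg_eq (v : V) (p : ℚ) : A.adjointArg v p = ∑ᶠ k : ℕ,
    A.expL1Coeff k (A.expL0 (Real.pi * Complex.I) (A.proj (-(p - k) / 2) v)) := rfl

theorem hasFiniteSupport_adjointArg (v : V) (p : ℚ) : Function.HasFiniteSupport fun k : ℕ =>
    A.expL1Coeff k (A.expL0 (Real.pi * Complex.I) (A.proj (-(p - k) / 2) v)) := by
  obtain ⟨s, hs, -⟩ := A.sum_support_proj v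
  refine (s.finite_toSet.preimage (f := fun k : ℕ => -(p - k) / 2) ?_).subset fun k hk => ?_
  · intro a _ b _ h
    have h : -(p - (a : ℚ)) / 2 = -(p - b) / 2 := h
    exact_mod_cast (by linarith : (a : ℚ) = b)
  · by_contra h
    exact hk (by dsimp only; rw [hs _ h, map_zero, map_zero])

theorem adjointArg_add (u v : V) (p : ℚ) :
    A.adjointArg (u + v) p = A.adjointArg u p + A.adjointArg v p := by
  simp only [adjointArg_eq, map_add]
  exact finsum_add_distrib (hasFiniteSupport_adjointArg u p) (hasFiniteSupport_adjointArg v p)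

theorem adjointArg_smul (c : ℂ) (v : V) (p : ℚ) :
    A.adjointArg (c • v) p = c • A.adjointArg v p := by
  simp only [adjointArg_eq, map_smul, smul_finsum]

theorem adjointArg_of_mem {α : ℚ} {v : V} (hv : v ∈ A.weightSpace α) (s : ℕ) {p : ℚ}
    (hp : p = s - 2 * α) :
    A.adjointArg v p = Complex.exp (Real.pi * Complex.I * α) • A.expL1Coeff s v := by
  rw [adjointArg_eq, finsum_eq_single _ s, A.proj_of_mem hv, if_pos, A.expL0_of_mem hv, map_smul]
  · rw [hp]; ring
  · intro k hk
    rw [A.proj_of_mem hv, if_neg, map_zero, map_zero]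
    intro h
    exact hk (by exact_mod_cast (by linarith : (k : ℚ) = s))

theorem adjointArg_of_mem_eq_zero {α : ℚ} {v : V} (hv : v ∈ A.weightSpace α) {p : ℚ}
    (hp : ∀ s : ℕ, p ≠ s - 2 * α) : A.adjointArg v p = 0 := by
  rw [adjointArg_eq, finsum_eq_zero_of_forall_eq_zero]
  intro k
  rw [A.proj_of_mem hv, if_neg, map_zero, map_zero]
  intro h
  exact hp k (by linarith)

theorem finite_support_adjointArg (v : V) (q : ℚ) :
    {n : ℤ | A.adjointArg v (q - (n + 1)) ≠ 0}.Finite := by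
  induction v using A.induction_weight with
  | zero =>
    have h (p : ℚ) : A.adjointArg 0 p = 0 := by simpa using adjointArg_smul (A := A) 0 0 p
    simp [h]
  | add u v hu hv =>
    refine (hu.union hv).subset fun n hn => ?_
    by_contra h
    simp only [Set.mem_union, Set.mem_ofPred_eq, not_or, not_not] at h
    exact hn (by rw [adjointArg_add, h.1, h.2, add_zero])
  | weight α v hv =>
    obtain ⟨S, hS⟩ := A.exists_expL1Coeff_eq_zero v v
    refine ((range S).finite_toSet.image fun s : ℕ => ⌊q + 2 * α - 1 - s⌋).subset fun n hn => ?_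
    by_contra h
    refine hn ?_
    by_cases hs : ∃ s : ℕ, q - (n + 1) = s - 2 * α
    · obtain ⟨s, hs⟩ := hs
      rw [adjointArg_of_mem hv s hs, (hS s _).1, smul_zero]
      by_contra hlt
      refine h ⟨s, by simpa using hlt, ?_⟩
      dsimp only
      rw [show q + 2 * α - 1 - s = (n : ℚ) by linarith, Int.floor_intCast]
    · exact adjointArg_of_mem_eq_zero hv fun s h => hs ⟨s, h⟩

end QGradedVOA

namespace VOAModule

open QGradedVOA

variable {V : Type*} [AddCommGroup V] [Module ℂ V] {A : QGradedVOA V}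
  {W : Type*} [AddCommGroup W] [Module ℂ W] (M : VOAModule A W)

theorem hasFiniteSupport_vmode_adjointArg (v : V) (q : ℚ) :
    Function.HasFiniteSupport fun n : ℤ => vmode M.Y (A.adjointArg v (q - (n + 1))) n :=
  (finite_support_adjointArg v q).subset fun n hn h =>
    hn (by dsimp only; rw [h, vmode_zero])

/-- The coefficient of `z^q` in `Y_W(e^{zL(1)} e^{πiL(0)} z^{-2L(0)} v, z⁻¹)`. -/
def adjOp (q : ℚ) : V →ₗ[ℂ] Module.End ℂ W where
  toFun v := ∑ᶠ n : ℤ, vmode M.Y (A.adjointArg v (q - (n + 1))) n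
  map_add' u v := by
    simp only [adjointArg_add, vmode_add]
    exact finsum_add_distrib (M.hasFiniteSupport_vmode_adjointArg u q)
      (M.hasFiniteSupport_vmode_adjointArg v q)
  map_smul' c v := by simp only [adjointArg_smul, vmode_smul, smul_finsum, RingHom.id_apply]

theorem adjOp_of_mem {α : ℚ} {v : V} (hv : v ∈ A.weightSpace α) {q : ℚ} {a : ℤ}
    (ha : q + 2 * α - 1 = a) :
    M.adjOp q v = Complex.exp (Real.pi * Complex.I * α) • A.oppMode M.Y v a := by
  obtain ⟨S, hS⟩ := A.exists_expL1Coeff_eq_zero v v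
  rw [oppMode_eq_sum fun s hs => (hS s hs).1, smul_sum]
  have hinj : Set.InjOn (fun s : ℕ => a - (s : ℤ)) (range S) := by
    intro s _ t _ h
    have h : a - (s : ℤ) = a - t := h
    omega
  have hterm (s : ℕ) : A.adjointArg v (q - ((a - s : ℤ) + 1)) =
      Complex.exp (Real.pi * Complex.I * α) • A.expL1Coeff s v :=
    adjointArg_of_mem hv s (by push_cast; linarith)
  refine (finsum_eq_sum_of_support_subset (s := (range S).image fun s : ℕ => a - (s : ℤ)) _
    fun n hn => ?_).trans ((sum_image hinj).trans (sum_congr rfl fun s _ => ?_))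
  · by_contra h
    refine hn ?_
    by_cases hs : ∃ s : ℕ, n = a - s
    · obtain ⟨s, rfl⟩ := hs
      have hle : S ≤ s := by
        by_contra hlt
        exact h (by simpa using hlt)
      dsimp only
      rw [hterm, (hS s hle).1, smul_zero, vmode_zero]
    · dsimp only
      rw [adjointArg_of_mem_eq_zero hv, vmode_zero]
      intro s h
      exact hs ⟨s, by exact_mod_cast (by linarith : (n : ℚ) = a - s)⟩
  · rw [hterm, vmode_smul]

theorem adjOp_of_mem_eq_zero {α : ℚ} {v : V} (hv : v ∈ A.weightSpace α) {q : ℚ}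
    (hq : ∀ a : ℤ, q + 2 * α ≠ a) : M.adjOp q v = 0 := by
  refine finsum_eq_zero_of_forall_eq_zero fun n => ?_
  rw [adjointArg_of_mem_eq_zero hv, vmode_zero]
  intro s h
  exact hq (n + 1 + s) (by push_cast; linarith)

/-! ### Weights on a module and the restricted dual -/

theorem mem_weightSpace {γ : ℂ} {w : W} :
    w ∈ M.weightSpace γ ↔ vmode M.Y A.omega 1 w = γ • w :=
  Module.End.mem_eigenspace_iff

theorem vmode_mem_weightSpace {α : ℚ} {γ : ℂ} {u : V} {w : W} (hu : u ∈ A.weightSpace α)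
    (hw : w ∈ M.weightSpace γ) (n : ℤ) : vmode M.Y u n w ∈ M.weightSpace (γ + α - n - 1) := by
  rw [mem_weightSpace] at hw ⊢
  rw [L_zero_vmode M.jacobi M.vacuum hu n w, hw, map_smul, ← add_smul]
  congr 1
  ring

theorem adjOp_mem_weightSpace {α : ℚ} {γ : ℂ} {v : V} {w : W} (hv : v ∈ A.weightSpace α)
    (hw : w ∈ M.weightSpace γ) (q : ℚ) : M.adjOp q v w ∈ M.weightSpace (γ - α - q) := by
  by_cases h : ∃ a : ℤ, q + 2 * α = a
  · obtain ⟨a, ha⟩ := h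
    obtain ⟨S, hS⟩ := A.exists_expL1Coeff_eq_zero v v
    rw [M.adjOp_of_mem hv (a := a - 1) (by push_cast; linarith),
      oppMode_eq_sum fun s hs => (hS s hs).1]
    refine Submodule.smul_mem _ _ ?_
    rw [LinearMap.sum_apply]
    refine Submodule.sum_mem _ fun s _ => ?_
    have ha' : (q : ℂ) + 2 * α = a := by exact_mod_cast congrArg (Rat.cast : ℚ → ℂ) ha
    convert M.vmode_mem_weightSpace (A.expL1Coeff_mem_weightSpace hv s) hw (a - 1 - s) using 2
    push_cast
    linear_combination -ha'
  · rw [M.adjOp_of_mem_eq_zero hv fun a ha => h ⟨a, ha⟩]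
    exact Submodule.zero_mem _

theorem decomp_of_mem {γ : ℂ} {w : W} (hw : w ∈ M.weightSpace γ) :
    M.decomp w = DirectSum.lof ℂ ℂ (fun γ => M.weightSpace γ) γ ⟨w, hw⟩ :=
  (LinearEquiv.symm_apply_eq _).2 (DirectSum.coeLinearMap_lof M.weightSpace γ ⟨w, hw⟩).symm

theorem dual_ext {f g : Module.Dual ℂ W} (h : ∀ γ, ∀ w ∈ M.weightSpace γ, f w = g w) : f = g := by
  have hf : f ∘ₗ M.decomp.symm.toLinearMap = g ∘ₗ M.decomp.symm.toLinearMap := by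
    refine DirectSum.linearMap_ext ℂ fun γ => LinearMap.ext fun x => ?_
    have hx : M.decomp.symm (DirectSum.lof ℂ ℂ (fun γ => M.weightSpace γ) γ x) = x := by
      rw [LinearEquiv.symm_apply_eq]
      exact (M.decomp_of_mem x.2).symm
    simpa [hx] using h γ x x.2
  ext w
  simpa using congrArg (fun f => f (M.decomp w)) hf

theorem pairing_of_mem (w' : M.RestrictedDual) {γ : ℂ} {w : W} (hw : w ∈ M.weightSpace γ) :
    M.pairing w' w = w' γ ⟨w, hw⟩ := by
  induction w' using DirectSum.induction_on with
  | zero => simp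
  | add x y hx hy => simp [hx, hy]
  | of β φ =>
    simp only [pairing, ← DirectSum.lof_eq_of ℂ, DirectSum.toModule_lof, LinearMap.dualMap_apply,
      LinearMap.comp_apply, LinearEquiv.coe_coe, M.decomp_of_mem hw]
    simp only [DirectSum.lof_eq_of, ← DirectSum.apply_eq_component]
    by_cases h : β = γ
    · subst h; simp
    · rw [DirectSum.of_eq_of_ne _ _ _ h, DirectSum.of_eq_of_ne _ _ _ (Ne.symm h)]; simp

theorem pairing_injective : Function.Injective M.pairing := by
  refine (injective_iff_map_eq_zero _).2 fun w' h => ?_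
  refine DFinsupp.ext fun γ => LinearMap.ext fun x => ?_
  have h := M.pairing_of_mem w' x.2
  rw [‹M.pairing w' = 0›] at h
  exact h.symm

theorem eq_pairing_lof {f : Module.Dual ℂ W} {δ : ℂ}
    (hf : ∀ γ, γ ≠ δ → ∀ w ∈ M.weightSpace γ, f w = 0) :
    f = M.pairing (DirectSum.lof ℂ ℂ (fun γ => Module.Dual ℂ (M.weightSpace γ)) δ
      (f ∘ₗ (M.weightSpace δ).subtype)) := by
  refine M.dual_ext fun γ w hw => ?_
  rw [M.pairing_of_mem _ hw, DirectSum.lof_eq_of]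
  by_cases h : γ = δ
  · subst h; simp
  · rw [DirectSum.of_eq_of_ne _ _ _ h, hf γ h w hw]; rfl

theorem pairing_lof_of_mem_of_ne {β γ : ℂ} (h : γ ≠ β) (φ : Module.Dual ℂ (M.weightSpace β))
    {w : W} (hw : w ∈ M.weightSpace γ) :
    M.pairing (DirectSum.lof ℂ ℂ (fun γ => Module.Dual ℂ (M.weightSpace γ)) β φ) w = 0 := by
  rw [M.pairing_of_mem _ hw, DirectSum.lof_eq_of, DirectSum.of_eq_of_ne _ _ _ h]; rfl

/-- The transpose of `adjOp q v`, for `v` of weight `α`, maps `W_(β)^*` to `W_(β+α+q)^*`. -/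
theorem pairing_lof_comp_adjOp {α : ℚ} {v : V} (hv : v ∈ A.weightSpace α) (q : ℚ) (β : ℂ)
    (φ : Module.Dual ℂ (M.weightSpace β)) :
    ∃ ψ, M.pairing (DirectSum.lof ℂ ℂ (fun γ => Module.Dual ℂ (M.weightSpace γ)) β φ) ∘ₗ
        M.adjOp q v =
      M.pairing (DirectSum.lof ℂ ℂ (fun γ => Module.Dual ℂ (M.weightSpace γ)) (β + α + q) ψ) := by
  refine ⟨_, M.eq_pairing_lof fun γ hγ w hw => M.pairing_lof_of_mem_of_ne (fun h => hγ ?_) φ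
    (M.adjOp_mem_weightSpace hv hw q)⟩
  rw [← h]; ring

theorem pairing_comp_adjOp_mem_range (q : ℚ) (v : V) (w' : M.RestrictedDual) :
    M.pairing w' ∘ₗ M.adjOp q v ∈ LinearMap.range M.pairing := by
  induction v using A.induction_weight with
  | zero => simp
  | add u v hu hv => rw [map_add, LinearMap.comp_add]; exact Submodule.add_mem _ hu hv
  | weight α v hv =>
    induction w' using DirectSum.induction_on with
    | zero => simp
    | add x y hx hy => rw [map_add, LinearMap.add_comp]; exact Submodule.add_mem _ hx hy
    | of β φ =>
      obtain ⟨ψ, hψ⟩ := M.pairing_lof_comp_adjOp hv q β φ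
      exact ⟨_, hψ.symm⟩

theorem exists_transpose_adjOp (q : ℚ) : ∃ T : V →ₗ[ℂ] Module.End ℂ M.RestrictedDual,
    ∀ v w', M.pairing (T v w') = M.pairing w' ∘ₗ M.adjOp q v := by
  choose f hf using M.pairing_comp_adjOp_mem_range q
  refine ⟨LinearMap.mk₂ ℂ f (fun _ _ _ => M.pairing_injective ?_)
    (fun _ _ _ => M.pairing_injective ?_) (fun _ _ _ => M.pairing_injective ?_)
    (fun _ _ _ => M.pairing_injective ?_), fun v w' => hf v w'⟩
  · simp only [map_add, hf, LinearMap.comp_add]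
  · simp only [map_smul, hf, LinearMap.comp_smul]
  · simp only [map_add, hf, LinearMap.add_comp]
  · simp only [map_smul, hf, LinearMap.smul_comp]

/-- The transpose of `adjOp q v` on the restricted dual: the coefficient of `z^q` in
`Y_{W'}(v,z)`. -/
def dualMode (q : ℚ) : V →ₗ[ℂ] Module.End ℂ M.RestrictedDual :=
  (M.exists_transpose_adjOp q).choose

theorem pairing_dualMode (q : ℚ) (v : V) (w' : M.RestrictedDual) :
    M.pairing (M.dualMode q v w') = M.pairing w' ∘ₗ M.adjOp q v :=
  (M.exists_transpose_adjOp q).choose_spec v w'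

theorem dualMode_eq_zero {q : ℚ} {v : V} (h : M.adjOp q v = 0) : M.dualMode q v = 0 :=
  LinearMap.ext fun w' => M.pairing_injective <| by rw [pairing_dualMode, h]; simp

/-- `Y_{W'}(v,z)w'` has only finitely many negative powers of `z`. -/
theorem eventually_dualMode_eq_zero (v : V) (w' : M.RestrictedDual) :
    ∀ᶠ q : ℚ in atBot, M.dualMode q v w' = 0 := by
  induction v using A.induction_weight with
  | zero => simp
  | add u v hu hv => filter_upwards [hu, hv] with q h₁ h₂; simp [h₁, h₂]
  | weight α v hv =>
    induction w' using DirectSum.induction_on with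
    | zero => simp
    | add x y hx hy => filter_upwards [hx, hy] with q h₁ h₂; simp [h₁, h₂]
    | of β φ =>
      -- `q + 2α` is an integer when the operator is not zero, so `β + α + q ∈ (β - α) + ℤ`
      obtain ⟨N, hN⟩ := M.grading.truncated (β - α)
      filter_upwards [eventually_lt_atBot ((N : ℚ) - 2 * α)] with q hq
      by_cases h : ∃ a : ℤ, q + 2 * α = a
      · obtain ⟨a, ha⟩ := h
        obtain ⟨ψ, hψ⟩ := M.pairing_lof_comp_adjOp hv q β φ
        refine M.pairing_injective ?_
        rw [pairing_dualMode, ← DirectSum.lof_eq_of ℂ, hψ]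
        have haN : a < N := by exact_mod_cast (by linarith : (a : ℚ) < N)
        have ha' : (q : ℂ) + 2 * α = a := by exact_mod_cast congrArg (Rat.cast : ℚ → ℂ) ha
        have hbot : M.weightSpace (β + α + q) = ⊥ := by
          rw [← hN a haN, ← ha', weightSpace]
          congr 1; ring
        have : ψ = 0 := by
          ext ⟨x, hx⟩
          rw [hbot, Submodule.mem_bot] at hx
          subst hx
          exact map_zero ψ
        rw [this, map_zero]
      · rw [M.dualMode_eq_zero (M.adjOp_of_mem_eq_zero hv fun a ha => h ⟨a, ha⟩)]; rfl

theorem isAdjoint_iff (k : ℕ) (Y' : V →ₗ[ℂ] VertexOperator ℂ M.RestrictedDual) :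
    M.IsAdjoint k Y' ↔ ∀ v q, fracCoeff k (Y' v) q = M.dualMode q v := by
  have h (v : V) (w' : M.RestrictedDual) (w : W) (q : ℚ) :
      ∑ᶠ n : ℤ, M.pairing w' (vmode M.Y (A.adjointArg v (q - (n + 1))) n w) =
        M.pairing (M.dualMode q v w') w := by
    rw [pairing_dualMode]
    exact (map_finsum (M.pairing w' ∘ₗ LinearMap.applyₗ w)
      (M.hasFiniteSupport_vmode_adjointArg v q)).symm
  simp only [IsAdjoint, h]
  refine ⟨fun H v q => LinearMap.ext fun w' => M.pairing_injective <| LinearMap.ext fun w =>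
    H v w' w q, fun H v w' w q => by rw [H]⟩

end VOAModule

/-! ### The Jacobi identity on the restricted dual -/

namespace VOAModule

open QGradedVOA

variable {V : Type*} [AddCommGroup V] [Module ℂ V] {A : QGradedVOA V}
  {W : Type*} [AddCommGroup W] [Module ℂ W] (M : VOAModule A W)

theorem eventually_dualMode_neg_eq_zero (v : V) (w' : M.RestrictedDual) (n : ℚ) :
    ∀ᶠ i : ℕ in atTop, M.dualMode (-(n + i) - 1) v w' = 0 := by
  refine Tendsto.eventually ?_ (M.eventually_dualMode_eq_zero v w')
  have h : Tendsto (fun i : ℕ => n + (i : ℚ)) atTop atTop :=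
    tendsto_atTop_add_const_left _ n tendsto_natCast_atTop_atTop
  simpa only [sub_eq_add_neg, Function.comp_def] using
    tendsto_atBot_add_const_right _ (-1 : ℚ) (tendsto_neg_atTop_atBot.comp h)

theorem eventually_dualMode_vmode_eq_zero (u v : V) (w' : M.RestrictedDual) (l : ℤ)
    (c : ℕ → ℂ) (q : ℕ → ℚ) :
    ∀ᶠ i : ℕ in atTop, c i • M.dualMode (q i) (vmode A.Y u (l + i) v) w' = 0 := by
  filter_upwards [eventually_vmode_eq_zero A.Y u v l] with i hi
  rw [hi]; simp

theorem eventually_dualMode_dualMode_eq_zero (u v : V) (w' : M.RestrictedDual) (n : ℚ)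
    (c : ℕ → ℂ) (q : ℕ → ℚ) :
    ∀ᶠ i : ℕ in atTop, c i • M.dualMode (q i) u (M.dualMode (-(n + i) - 1) v w') = 0 := by
  filter_upwards [M.eventually_dualMode_neg_eq_zero v w' n] with i hi
  rw [hi]; simp

/-- The `(l, m, n)` component of the twisted Jacobi identity on the restricted dual. The mode of
index `q` is the coefficient of `z^(-q-1)`, hence the arguments of `dualMode`. No condition on `m` is
included. -/
def DualJacobi (u v : V) (w' : M.RestrictedDual) (l : ℤ) (m n : ℚ) : Prop :=
  (∑ᶠ i : ℕ, ((-1 : ℂ) ^ i * Ring.choose (l : ℂ) i) •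
      M.dualMode (-(l + m - i) - 1) u (M.dualMode (-(n + i) - 1) v w'))
    - (∑ᶠ i : ℕ, ((-1 : ℂ) ^ (l + i) * Ring.choose (l : ℂ) i) •
      M.dualMode (-(l + n - i) - 1) v (M.dualMode (-(m + i) - 1) u w'))
  = ∑ᶠ i : ℕ, Ring.choose (m : ℂ) i • M.dualMode (-(m + n - i) - 1) (vmode A.Y u (l + i) v) w'

variable {M} {w' : M.RestrictedDual} {l : ℤ} {m n : ℚ}

theorem DualJacobi.zero_left (v : V) : M.DualJacobi 0 v w' l m n := by
  simp [DualJacobi, vmode_zero]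

theorem DualJacobi.zero_right (u : V) : M.DualJacobi u 0 w' l m n := by
  simp [DualJacobi]

theorem DualJacobi.add_left {u₁ u₂ v : V} (h₁ : M.DualJacobi u₁ v w' l m n)
    (h₂ : M.DualJacobi u₂ v w' l m n) : M.DualJacobi (u₁ + u₂) v w' l m n := by
  unfold DualJacobi at *
  simp only [map_add, vmode_add, LinearMap.add_apply, smul_add]
  rw [finsum_add_distrib, finsum_add_distrib, finsum_add_distrib, ← h₁, ← h₂]
  · abel
  · exact hasFiniteSupport_of_eventually (M.eventually_dualMode_vmode_eq_zero _ _ _ _ _ _)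
  · exact hasFiniteSupport_of_eventually (M.eventually_dualMode_vmode_eq_zero _ _ _ _ _ _)
  · exact hasFiniteSupport_of_eventually (M.eventually_dualMode_dualMode_eq_zero _ _ _ _ _ _)
  · exact hasFiniteSupport_of_eventually (M.eventually_dualMode_dualMode_eq_zero _ _ _ _ _ _)
  · exact hasFiniteSupport_of_eventually (M.eventually_dualMode_dualMode_eq_zero _ _ _ _ _ _)
  · exact hasFiniteSupport_of_eventually (M.eventually_dualMode_dualMode_eq_zero _ _ _ _ _ _)

theorem DualJacobi.add_right {u v₁ v₂ : V} (h₁ : M.DualJacobi u v₁ w' l m n)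
    (h₂ : M.DualJacobi u v₂ w' l m n) : M.DualJacobi u (v₁ + v₂) w' l m n := by
  unfold DualJacobi at *
  simp only [map_add, LinearMap.add_apply, smul_add]
  rw [finsum_add_distrib, finsum_add_distrib, finsum_add_distrib, ← h₁, ← h₂]
  · abel
  · exact hasFiniteSupport_of_eventually (M.eventually_dualMode_vmode_eq_zero _ _ _ _ _ _)
  · exact hasFiniteSupport_of_eventually (M.eventually_dualMode_vmode_eq_zero _ _ _ _ _ _)
  · exact hasFiniteSupport_of_eventually (M.eventually_dualMode_dualMode_eq_zero _ _ _ _ _ _)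
  · exact hasFiniteSupport_of_eventually (M.eventually_dualMode_dualMode_eq_zero _ _ _ _ _ _)
  · exact hasFiniteSupport_of_eventually (M.eventually_dualMode_dualMode_eq_zero _ _ _ _ _ _)
  · exact hasFiniteSupport_of_eventually (M.eventually_dualMode_dualMode_eq_zero _ _ _ _ _ _)

theorem pairing_finsum {f : ℕ → M.RestrictedDual} (hf : ∀ᶠ i in atTop, f i = 0) (w : W) :
    M.pairing (∑ᶠ i, f i) w = ∑ᶠ i, M.pairing (f i) w :=
  map_finsum (LinearMap.applyₗ w ∘ₗ M.pairing) (hasFiniteSupport_of_eventually hf)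

theorem finsum_pairing {f : ℕ → W} (hf : ∀ᶠ i in atTop, f i = 0) (w' : M.RestrictedDual) :
    ∑ᶠ i, M.pairing w' (f i) = M.pairing w' (∑ᶠ i, f i) :=
  (map_finsum (M.pairing w') (hasFiniteSupport_of_eventually hf)).symm

theorem pairing_dualMode_apply (q : ℚ) (v : V) (w' : M.RestrictedDual) (w : W) :
    M.pairing (M.dualMode q v w') w = M.pairing w' (M.adjOp q v w) := by
  rw [pairing_dualMode]; rfl

/-- For homogeneous vectors the Jacobi identity on `W'` is the transpose of `oppMode_jacobi`. -/
theorem DualJacobi.of_mem {α β : ℚ} {u v : V} (hu : u ∈ A.weightSpace α)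
    (hv : v ∈ A.weightSpace β) (hm : ∃ z : ℤ, m = 2 * α + z) : M.DualJacobi u v w' l m n := by
  obtain ⟨z, rfl⟩ := hm
  have huv (i : ℕ) := A.vmode_mem_weightSpace hu hv (l + i)
  by_cases hn : ∃ y : ℤ, n = 2 * β + y
  · obtain ⟨y, rfl⟩ := hn
    refine M.pairing_injective (LinearMap.ext fun w => ?_)
    set a : ℤ := -z - l - 2 with ha
    set b : ℤ := -y - l - 2 with hb
    have e₁ (i : ℕ) : M.adjOp (-(l + (2 * α + z) - i) - 1) u =
        Complex.exp (Real.pi * Complex.I * α) • A.oppMode M.Y u (a + i) :=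
      M.adjOp_of_mem hu (by rw [ha]; push_cast; ring)
    have e₂ (i : ℕ) : M.adjOp (-((2 * β + y) + i) - 1) v =
        Complex.exp (Real.pi * Complex.I * β) • A.oppMode M.Y v (b + l - i) :=
      M.adjOp_of_mem hv (by rw [hb]; push_cast; ring)
    have e₃ (i : ℕ) : M.adjOp (-(l + (2 * β + y) - i) - 1) v =
        Complex.exp (Real.pi * Complex.I * β) • A.oppMode M.Y v (b + i) :=
      M.adjOp_of_mem hv (by rw [hb]; push_cast; ring)
    have e₄ (i : ℕ) : M.adjOp (-((2 * α + z) + i) - 1) u =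
        Complex.exp (Real.pi * Complex.I * α) • A.oppMode M.Y u (a + l - i) :=
      M.adjOp_of_mem hu (by rw [ha]; push_cast; ring)
    have hexp (i : ℕ) : Complex.exp (Real.pi * Complex.I * ((α + β - (l + i : ℤ) - 1 : ℚ) : ℂ)) =
        Complex.exp (Real.pi * Complex.I * α) * Complex.exp (Real.pi * Complex.I * β) *
          (-1) ^ (l + 1 + i) := by
      have : (-1 : ℂ) ^ (l + 1 + i) = Complex.exp (Real.pi * Complex.I * (-(l + 1 + i : ℤ))) := by
        have h : (-1 : ℂ) ^ (l + 1 + i) = (-1) ^ (-(l + 1 + i)) := by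
          rw [zpow_neg, ← inv_zpow]; norm_num
        rw [h, ← Complex.exp_pi_mul_I, ← Complex.exp_int_mul]
        congr 1
        push_cast; ring
      rw [this, ← Complex.exp_add, ← Complex.exp_add]
      congr 1
      push_cast; ring
    have e₅ (i : ℕ) : M.adjOp (-((2 * α + z) + (2 * β + y) - i) - 1) (vmode A.Y u (l + i) v) =
        (Complex.exp (Real.pi * Complex.I * α) * Complex.exp (Real.pi * Complex.I * β) *
          (-1) ^ (l + 1 + i)) • A.oppMode M.Y (vmode A.Y u (l + i) v) (a + b - i) := by
      rw [← hexp]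
      exact M.adjOp_of_mem (huv i) (by rw [ha, hb]; push_cast; ring)
    have hm : ((2 * α + z : ℚ) : ℂ) = 2 * α - a - l - 2 := by rw [ha]; push_cast; ring
    have key := congrArg (fun x => (Complex.exp (Real.pi * Complex.I * α) *
      Complex.exp (Real.pi * Complex.I * β)) • M.pairing w' x)
      (oppMode_jacobi M.jacobi hu v w l a b)
    rw [map_sub, LinearMap.sub_apply, pairing_finsum, pairing_finsum, pairing_finsum]
    · simp only [map_smul, LinearMap.smul_apply, pairing_dualMode_apply, e₁, e₂, e₃, e₄, e₅, hm]
      rw [map_sub, ← finsum_pairing, ← finsum_pairing, ← finsum_pairing, smul_sub, smul_finsum,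
        smul_finsum, smul_finsum] at key
      · refine (congrArg₂ (· - ·) (finsum_congr fun i => ?_) (finsum_congr fun i => ?_)).trans
          (key.trans (finsum_congr fun i => ?_))
        all_goals simp only [map_smul, smul_eq_mul]; ring
      · exact (eventually_vmode_eq_zero A.Y u v l).mono fun i hi => by
          rw [hi, oppMode_zero]; simp
      · exact (eventually_oppMode_eq_zero M.Y v w b).mono fun i hi => by rw [hi]; simp
      · exact (eventually_oppMode_eq_zero M.Y u w a).mono fun i hi => by rw [hi]; simp
    · exact M.eventually_dualMode_vmode_eq_zero _ _ _ _ _ _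
    · exact M.eventually_dualMode_dualMode_eq_zero _ _ _ _ _ _
    · exact M.eventually_dualMode_dualMode_eq_zero _ _ _ _ _ _
  · -- no term contributes, since `Y_{W'}(v,z)` has only powers of `z` in `-2β + ℤ`
    have e₂ (i : ℕ) : M.dualMode (-(n + i) - 1) v = 0 :=
      M.dualMode_eq_zero <| M.adjOp_of_mem_eq_zero hv fun a h =>
        hn ⟨-a - i - 1, by push_cast; linarith⟩
    have e₃ (i : ℕ) : M.dualMode (-(l + n - i) - 1) v = 0 :=
      M.dualMode_eq_zero <| M.adjOp_of_mem_eq_zero hv fun a h =>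
        hn ⟨-a - l + i - 1, by push_cast; linarith⟩
    have e₅ (i : ℕ) : M.dualMode (-(2 * α + z + n - i) - 1) (vmode A.Y u (l + i) v) = 0 :=
      M.dualMode_eq_zero <| M.adjOp_of_mem_eq_zero (huv i) fun a h =>
        hn ⟨-a - z - 2 * l - i - 3, by push_cast at h ⊢; linarith⟩
    unfold DualJacobi
    simp only [e₂, e₃, e₅, LinearMap.zero_apply, map_zero, smul_zero, finsum_zero, sub_zero]

theorem DualJacobi.of_proj {u : V} (hu : ∀ α, A.proj α u ≠ 0 → ∃ z : ℤ, m = 2 * α + z) (v : V) :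
    M.DualJacobi u v w' l m n := by
  obtain ⟨s, -, hs⟩ := A.sum_support_proj u
  rw [hs]
  refine Finset.sum_induction _ (fun x => M.DualJacobi x v w' l m n) (fun _ _ => add_left)
    (zero_left v) fun α _ => ?_
  by_cases h : A.proj α u = 0
  · rw [h]; exact zero_left v
  · induction v using A.induction_weight with
    | zero => exact zero_right _
    | add v₁ v₂ h₁ h₂ => exact add_right h₁ h₂
    | weight β v hv => exact of_mem (A.proj_mem α u) hv (hu α h)

/-! ### The grading of the restricted dual -/

theorem pairing_dualMode_omega (w' : M.RestrictedDual) {γ : ℂ} {w : W}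
    (hw : w ∈ M.weightSpace γ) :
    M.pairing (M.dualMode (-2) A.omega w') w = γ * M.pairing w' w := by
  have hexp : Complex.exp (Real.pi * Complex.I * ((2 : ℚ) : ℂ)) = 1 := by
    rw [← Complex.exp_two_pi_mul_I]; congr 1; push_cast; ring
  rw [pairing_dualMode_apply, M.adjOp_of_mem A.omega_mem_weightSpace (a := 1) (by norm_num),
    oppMode_of_L_one_eq_zero A.L_one_omega, hexp, one_smul, M.mem_weightSpace.1 hw, map_smul,
    smul_eq_mul]

/-- The eigenspace of `L(0)` on `W'` with eigenvalue `α` is `W_(α)^*`. -/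
theorem mem_eigenspace_dualMode_omega {α : ℂ} {w' : M.RestrictedDual} :
    w' ∈ (M.dualMode (-2) A.omega).eigenspace α ↔
      ∃ φ, w' = DirectSum.lof ℂ ℂ (fun γ => Module.Dual ℂ (M.weightSpace γ)) α φ := by
  rw [Module.End.mem_eigenspace_iff]
  constructor
  · intro h
    refine ⟨_, M.pairing_injective (M.eq_pairing_lof fun γ hγ w hw => ?_)⟩
    have h₁ := pairing_dualMode_omega w' hw
    rw [h, map_smul, LinearMap.smul_apply, smul_eq_mul] at h₁
    exact (mul_eq_mul_right_iff.1 h₁).resolve_left (Ne.symm hγ)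
  · rintro ⟨φ, rfl⟩
    refine M.pairing_injective (M.dual_ext fun γ w hw => ?_)
    rw [pairing_dualMode_omega _ hw, map_smul, LinearMap.smul_apply, smul_eq_mul]
    by_cases h : γ = α
    · rw [h]
    · rw [M.pairing_lof_of_mem_of_ne h φ hw, mul_zero, mul_zero]

theorem gradingRestrictions_dualMode_omega : GradingRestrictions (M.dualMode (-2) A.omega) where
  isInternal := by
    refine DirectSum.isInternal_submodule_of_iSupIndep_of_iSup_eq_top
      (Module.End.eigenspaces_iSupIndep _) (eq_top_iff.2 fun w' _ => ?_)
    induction w' using DirectSum.induction_on with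
    | zero => exact Submodule.zero_mem _
    | add x y hx hy => exact Submodule.add_mem _ (hx trivial) (hy trivial)
    | of α φ => exact Submodule.mem_iSup_of_mem α (mem_eigenspace_dualMode_omega.2 ⟨φ, rfl⟩)
  finiteDimensional α := by
    have := M.grading.finiteDimensional α
    have : FiniteDimensional ℂ (M.weightSpace α) := this
    refine Submodule.finiteDimensional_of_le (S₂ := LinearMap.range
      (DirectSum.lof ℂ ℂ (fun γ => Module.Dual ℂ (M.weightSpace γ)) α)) fun w' hw' => ?_
    obtain ⟨φ, rfl⟩ := mem_eigenspace_dualMode_omega.1 hw'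
    exact ⟨φ, rfl⟩
  truncated α := by
    obtain ⟨N, hN⟩ := M.grading.truncated α
    refine ⟨N, fun n hn => (Submodule.eq_bot_iff _).2 fun w' hw' => ?_⟩
    obtain ⟨φ, rfl⟩ := mem_eigenspace_dualMode_omega.1 hw'
    have hbot : M.weightSpace (α + n) = ⊥ := hN n hn
    have : φ = 0 := by
      ext ⟨x, hx⟩
      rw [hbot, Submodule.mem_bot] at hx
      subst hx
      exact map_zero φ
    rw [this, map_zero]

end VOAModule

/-! ### The automorphism `e^{4πiL(0)}` and its order -/

theorem exp_four_pi_eq_iff {α c : ℚ} :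
    Complex.exp (4 * Real.pi * Complex.I * α) = Complex.exp (2 * Real.pi * Complex.I * c) ↔
      ∃ n : ℤ, 2 * α = c + n := by
  have hpi : (2 * Real.pi * Complex.I : ℂ) ≠ 0 := Complex.two_pi_I_ne_zero
  rw [Complex.exp_eq_exp_iff_exists_int]
  refine exists_congr fun n => ⟨fun h => ?_, fun h => ?_⟩
  · have : (2 * Real.pi * Complex.I : ℂ) * ((2 * α : ℚ) : ℂ) =
        (2 * Real.pi * Complex.I) * ((c + n : ℚ) : ℂ) := by
      push_cast; linear_combination h
    exact_mod_cast mul_left_cancel₀ hpi this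
  · have h : (2 * α : ℂ) = c + n := by exact_mod_cast congrArg (Rat.cast : ℚ → ℂ) h
    linear_combination (2 * Real.pi * Complex.I : ℂ) * h

namespace QGradedVOA

variable {V : Type*} [AddCommGroup V] [Module ℂ V] {A : QGradedVOA V}

theorem expL0_pow_of_mem {α : ℚ} {v : V} (hv : v ∈ A.weightSpace α) (s : ℂ) (j : ℕ) :
    (A.expL0 s ^ j) v = Complex.exp (s * α) ^ j • v := by
  induction j with
  | zero => simp
  | succ j ih => rw [pow_succ', Module.End.mul_apply, ih, map_smul, A.expL0_of_mem hv, smul_smul,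
      pow_succ]

theorem proj_expL0 (s : ℂ) (α : ℚ) (v : V) :
    A.proj α (A.expL0 s v) = Complex.exp (s * α) • A.proj α v := by
  induction v using A.induction_weight with
  | zero => simp
  | add u v hu hv => simp only [map_add, hu, hv, smul_add]
  | weight β v hv =>
    rw [A.expL0_of_mem hv, map_smul, A.proj_of_mem hv]
    split_ifs with h
    · rw [h]
    · simp

theorem expL0_pow_eq_one {r : ℕ} (hr : 0 < r)
    (hV : ∀ α : ℚ, A.weightSpace α ≠ ⊥ → ∃ n : ℤ, α = (n : ℚ) / (2 * r)) :
    A.expL0 (4 * Real.pi * Complex.I) ^ r = 1 := by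
  ext v
  induction v using A.induction_weight with
  | zero => simp
  | add u v hu hv => rw [map_add, map_add, hu, hv]
  | weight α v hv =>
    by_cases h : v = 0
    · simp [h]
    obtain ⟨n, hn⟩ := hV α fun hbot => h (by rw [hbot] at hv; simpa using hv)
    have hr' : (r : ℂ) ≠ 0 := by exact_mod_cast hr.ne'
    rw [expL0_pow_of_mem hv, ← Complex.exp_nat_mul, Module.End.one_apply,
      Complex.exp_eq_one_iff.2 ⟨n, ?_⟩, one_smul]
    rw [hn]; push_cast; field_simp; ring

theorem isAutomorphism_expL0 {r : ℕ} (hr : 0 < r)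
    (hV : ∀ α : ℚ, A.weightSpace α ≠ ⊥ → ∃ n : ℤ, α = (n : ℚ) / (2 * r)) :
    A.IsAutomorphism (A.expL0 (4 * Real.pi * Complex.I)) where
  bijective := by
    have h := expL0_pow_eq_one hr hV
    exact (Module.End.isUnit_iff _).1 (IsUnit.of_pow_eq_one h hr.ne')
  map_one := by simp [A.expL0_of_mem A.one_mem_weightSpace]
  map_omega := by
    rw [A.expL0_of_mem A.omega_mem_weightSpace, Complex.exp_eq_one_iff.2 ⟨4, by push_cast; ring⟩,
      one_smul]
  map_mode u v n := by
    induction u using A.induction_weight with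
    | zero => simp [vmode_zero]
    | add u₁ u₂ h₁ h₂ => simp only [map_add, vmode_add, LinearMap.add_apply, h₁, h₂]
    | weight α u hu =>
      induction v using A.induction_weight with
      | zero => simp
      | add v₁ v₂ h₁ h₂ => simp only [map_add, h₁, h₂]
      | weight β v hv =>
        -- `u_n v` has weight `α + β - n - 1`, and `n + 1` is an integer
        have h : Complex.exp (4 * Real.pi * Complex.I * ((α + β - n - 1 : ℚ) : ℂ)) =
            Complex.exp (4 * Real.pi * Complex.I * α + 4 * Real.pi * Complex.I * β) :=
          Complex.exp_eq_exp_iff_exists_int.2 ⟨-2 * (n + 1), by push_cast; ring⟩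
        rw [A.expL0_of_mem hu, A.expL0_of_mem hv, A.expL0_of_mem (A.vmode_mem_weightSpace hu hv n),
          vmode_smul, LinearMap.smul_apply, map_smul, smul_smul, ← Complex.exp_add,
          h]

/-- The order of `e^{4πiL(0)}`, if finite, is a common denominator of twice the weights. -/
theorem two_mul_weight_mul_orderOf {α : ℚ} {v : V} (hv : v ∈ A.weightSpace α) (h : v ≠ 0) :
    ∃ z : ℤ, 2 * α * orderOf (A.expL0 (4 * Real.pi * Complex.I)) = z := by
  have h₁ := expL0_pow_of_mem hv (4 * Real.pi * Complex.I)
    (orderOf (A.expL0 (4 * Real.pi * Complex.I)))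
  rw [pow_orderOf_eq_one, Module.End.one_apply, ← Complex.exp_nat_mul] at h₁
  generalize orderOf (A.expL0 (4 * Real.pi * Complex.I)) = k at *
  have h₂ : Complex.exp (4 * Real.pi * Complex.I * ((k * α : ℚ) : ℂ)) =
      Complex.exp (2 * Real.pi * Complex.I * ((0 : ℚ) : ℂ)) := by
    have h₃ := smul_left_injective ℂ h ((one_smul ℂ v).trans h₁)
    rw [Rat.cast_zero, mul_zero, Complex.exp_zero, h₃]
    congr 1
    push_cast; ring
  obtain ⟨n, hn⟩ := exp_four_pi_eq_iff.1 h₂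
  exact ⟨n, by linarith⟩

end QGradedVOA

/-! ### The twisted module -/

section FracCoeff

variable {W : Type*} [AddCommGroup W] [Module ℂ W] {k : ℕ}

theorem fracCoeff_intCast_div (hk : 0 < k) (F : VertexOperator ℂ W) (n : ℤ) :
    fracCoeff k F ((n : ℚ) / k) = HVertexOperator.coeff F n := by
  have hk' : (k : ℚ) ≠ 0 := by exact_mod_cast hk.ne'
  rw [fracCoeff, div_mul_cancel₀ _ hk', if_pos (Rat.den_intCast n), Rat.num_intCast]

end FracCoeff

namespace VOAModule

open QGradedVOA

variable {V : Type*} [AddCommGroup V] [Module ℂ V] {A : QGradedVOA V}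
  {W : Type*} [AddCommGroup W] [Module ℂ W] (M : VOAModule A W)

/-- The vertex operator map on `W'` whose coefficient of `x^{n/k}` is `dualMode (n/k)`. -/
def dualY {k : ℕ} (hk : 0 < k) : V →ₗ[ℂ] VertexOperator ℂ M.RestrictedDual :=
  have hb (v : V) (w' : M.RestrictedDual) :
      BddBelow (Function.support fun n : ℤ => M.dualMode ((n : ℚ) / k) v w') := by
    obtain ⟨Q, hQ⟩ := eventually_atBot.1 (M.eventually_dualMode_eq_zero v w')
    refine ⟨⌊Q * k⌋, fun n hn => ?_⟩
    by_contra hlt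
    refine hn (hQ _ ?_)
    have hk' : (0 : ℚ) < k := by exact_mod_cast hk
    rw [div_le_iff₀ hk']
    exact Int.le_floor.1 (not_le.1 hlt).le
  { toFun v := VertexOperator.of_coeff (fun n => M.dualMode ((n : ℚ) / k) v) (hb v)
    map_add' u v := HVertexOperator.coeff_inj <| by
      rw [map_add]
      exact funext fun n => map_add (M.dualMode _) u v
    map_smul' c v := HVertexOperator.coeff_inj <| by
      rw [map_smul]
      exact funext fun n => map_smul (M.dualMode _) c v }

theorem coeff_dualY {k : ℕ} (hk : 0 < k) (v : V) (n : ℤ) :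
    HVertexOperator.coeff (M.dualY hk v) n = M.dualMode ((n : ℚ) / k) v := rfl

section Order

variable {M} {k : ℕ} (hk : 0 < k)
  (hA : ∀ (α : ℚ) (v : V), v ∈ A.weightSpace α → v ≠ 0 → ∃ z : ℤ, 2 * α * k = z)

include hk hA

theorem isAdjoint_dualY : M.IsAdjoint k (M.dualY hk) := by
  refine (M.isAdjoint_iff k _).2 fun v q => ?_
  by_cases h : (q * k).den = 1
  · have hk' : (k : ℚ) ≠ 0 := by exact_mod_cast hk.ne'
    rw [fracCoeff, if_pos h, coeff_dualY, (Rat.den_eq_one_iff _).1 h, mul_div_cancel_right₀ _ hk']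
  · rw [fracCoeff, if_neg h]
    symm
    induction v using A.induction_weight with
    | zero => exact map_zero _
    | add u v hu hv => rw [map_add, hu, hv, add_zero]
    | weight α v hv =>
      by_cases h₀ : v = 0
      · rw [h₀, map_zero]
      obtain ⟨z, hz⟩ := hA α v hv h₀
      refine M.dualMode_eq_zero (M.adjOp_of_mem_eq_zero hv fun a ha => h ?_)
      have : q * k = ((a * k - z : ℤ) : ℚ) := by push_cast; rw [← hz, ← ha]; ring
      rw [this, Rat.den_intCast]

theorem existsUnique_isAdjoint :
    ∃! Y' : V →ₗ[ℂ] VertexOperator ℂ M.RestrictedDual, M.IsAdjoint k Y' := by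
  refine ⟨M.dualY hk, isAdjoint_dualY hk hA, fun Y' hY' => LinearMap.ext fun v =>
    HVertexOperator.coeff_inj (funext fun n => ?_)⟩
  rw [coeff_dualY, ← fracCoeff_intCast_div hk, (M.isAdjoint_iff k Y').1 hY']

end Order

theorem isTwistedModule_of_isAdjoint {σ : Module.End ℂ V}
    (hσ : σ = A.expL0 (4 * Real.pi * Complex.I)) (hk : 0 < orderOf σ)
    {Y' : V →ₗ[ℂ] VertexOperator ℂ M.RestrictedDual} (hY' : M.IsAdjoint (orderOf σ) Y') :
    IsTwistedModule A σ Y' := by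
  rw [isAdjoint_iff] at hY'
  have hcoeff (v : V) (n : ℤ) :
      HVertexOperator.coeff (Y' v) n = M.dualMode ((n : ℚ) / orderOf σ) v := by
    rw [← fracCoeff_intCast_div hk, hY']
  have hmode (v : V) (q : ℚ) : fracMode (orderOf σ) Y' v q = M.dualMode (-q - 1) v := hY' v _
  have hk₀ : (orderOf σ : ℚ) ≠ 0 := by exact_mod_cast hk.ne'
  refine ⟨fun n => ?_, fun v n => ?_, fun j _ u hu v w' l m n hm => ?_, ?_⟩
  · rw [hcoeff]
    by_cases h : ∃ a : ℤ, (n : ℚ) / orderOf σ + 2 * 0 = a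
    · obtain ⟨a, ha⟩ := h
      refine LinearMap.ext fun w' => M.pairing_injective (LinearMap.ext fun w => ?_)
      have hna : n = 0 ↔ a = 0 := by
        rw [mul_zero, add_zero] at ha
        rw [← Int.cast_eq_zero (α := ℚ), ← Int.cast_eq_zero (n := a) (α := ℚ), ← ha,
          div_eq_zero_iff, or_iff_left hk₀]
      rw [pairing_dualMode_apply, M.adjOp_of_mem A.one_mem_weightSpace (a := a - 1)
        (by rw [ha]; push_cast; ring), oppMode_of_L_one_eq_zero A.L_one_one, M.vacuum]
      by_cases h0 : a = 0
      · simp [h0, hna.2 h0]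
      · rw [if_neg (by omega), if_neg (by rwa [hna])]; simp
    · rw [if_neg fun h0 => h ⟨0, by simp [h0]⟩,
        M.dualMode_eq_zero (M.adjOp_of_mem_eq_zero A.one_mem_weightSpace fun a ha => h ⟨a, ha⟩)]
  · rw [hcoeff, hcoeff]
    induction v using A.induction_weight with
    | zero => simp
    | add u v hu hv => simp only [map_add, hu, hv, smul_add]
    | weight α v hv =>
      rw [hσ, A.expL0_of_mem hv, ← hσ, map_smul]
      by_cases h : ∃ a : ℤ, (n : ℚ) / orderOf σ + 2 * α = a
      · obtain ⟨a, ha⟩ := h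
        congr 1
        rw [← Complex.exp_int_mul, show ((-n : ℤ) : ℂ) * (2 * Real.pi * Complex.I / orderOf σ) =
          2 * Real.pi * Complex.I * ((-(n : ℚ) / orderOf σ : ℚ) : ℂ) by push_cast; ring,
          exp_four_pi_eq_iff]
        exact ⟨a, by rw [← ha]; ring⟩
      · rw [M.dualMode_eq_zero (M.adjOp_of_mem_eq_zero hv fun a ha => h ⟨a, ha⟩), smul_zero,
          smul_zero]
  · obtain ⟨s, rfl⟩ := hm
    have hproj (α : ℚ) (hα : A.proj α u ≠ 0) :
        ∃ z : ℤ, (j : ℚ) / orderOf σ + s = 2 * α + z := by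
      have h := congrArg (A.proj α) hu
      rw [hσ, proj_expL0, ← hσ, map_smul, ← Complex.exp_nat_mul] at h
      have h := smul_left_injective ℂ hα h
      rw [show (j : ℂ) * (2 * Real.pi * Complex.I / orderOf σ) =
        2 * Real.pi * Complex.I * (((j : ℚ) / orderOf σ : ℚ) : ℂ) by push_cast; ring,
        exp_four_pi_eq_iff] at h
      obtain ⟨n, hn⟩ := h
      exact ⟨s - n, by rw [hn]; push_cast; ring⟩
    have e₁ (z : ℤ) (i : ℕ) : ((Ring.choose z i : ℤ) : ℂ) = Ring.choose (z : ℂ) i :=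
      Ring.map_choose (Int.castRingHom ℂ) z i
    have e₂ (q : ℚ) (i : ℕ) : ((Ring.choose q i : ℚ) : ℂ) = Ring.choose (q : ℂ) i :=
      Ring.map_choose (Rat.castHom ℂ) q i
    simp only [hmode, e₁, e₂]
    exact DualJacobi.of_proj hproj v
  · rw [hmode, show (-1 - 1 : ℚ) = -2 by norm_num]
    exact gradingRestrictions_dualMode_omega

end VOAModule

end

theorem proposition2p4 {V : Type*} [AddCommGroup V] [Module ℂ V] (A : QGradedVOA V)
    {W : Type*} [AddCommGroup W] [Module ℂ W] (M : VOAModule A W)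
    (r : ℕ) (hr : 0 < r)
    (hV : ∀ α : ℚ, A.weightSpace α ≠ ⊥ → ∃ n : ℤ, α = (n : ℚ) / (2 * r))
    (σ : Module.End ℂ V) (hσ : σ = A.expL0 (4 * Real.pi * Complex.I)) :
    A.IsAutomorphism σ ∧ σ ^ r = 1 ∧
    (∃! Y' : V →ₗ[ℂ] VertexOperator ℂ M.RestrictedDual, M.IsAdjoint (orderOf σ) Y') ∧
    (∀ Y' : V →ₗ[ℂ] VertexOperator ℂ M.RestrictedDual,
      M.IsAdjoint (orderOf σ) Y' → IsTwistedModule A σ Y') := by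
  have hpow : σ ^ r = 1 := hσ ▸ QGradedVOA.expL0_pow_eq_one hr hV
  have hk : 0 < orderOf σ := orderOf_pos_iff.2 (isOfFinOrder_iff_pow_eq_one.2 ⟨r, hr, hpow⟩)
  refine ⟨hσ ▸ QGradedVOA.isAutomorphism_expL0 hr hV, hpow,
    VOAModule.existsUnique_isAdjoint hk fun α v hv h => ?_,
    fun Y' hY' => M.isTwistedModule_of_isAdjoint hσ hk hY'⟩
  rw [hσ]
  exact QGradedVOA.two_mul_weight_mul_orderOf hv h
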